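/- Let $\mathbb{P}_0=\{(i,j,k)\in\mathbb{Z}^3 : i+j+k=0\}$, $e_{12}=(1,-1,0)$, $e_{23}=(0,1,-1)$, $e_{31}=(-1,0,1)$, and for $v=(i,j,k)\in\mathbb{P}_0$ let the color $\epsilon_v\in\{0,1,2\}$ be defined by $\epsilon_v\equiv j-k \pmod 3$. Fix two linearly independent vectors $A,B\in\mathbb{P}_0$ with $\epsilon_A=\epsilon_B=0$, let $\mathcal{T}(A,B)=\mathbb{P}_0/(\mathbb{Z}A+\mathbb{Z}B)$, and take one variable $x_u$ for each point $u$ of the finite set $\mathcal{T}(A,B)$ (so that, as functions on $\mathbb{P}_0$, $x_u=x_{u+A}=x_{u+B}$). The cube recurrence in the torus $\mathcal{T}(A,B)$ is the unique family of rational functions $f_v(t)$ in these variables, defined for $v\in\mathbb{P}_0$ and $t\in\mathbb{Z}$ with $t\equiv\epsilon_v \pmod 3$, such that $f_v(\epsilon_v)=x_v$ and $$f_v(t+3)f_v(t)=f_{v+e_{12}}(t+2)f_{v-e_{12}}(t+1)+f_{v+e_{23}}(t+2)f_{v-e_{23}}(t+1)+f_{v+e_{31}}(t+2)f_{v-e_{31}}(t+1).$$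 Then, for every vertex $v$, the values $f_v(\epsilon_v+\ell)$, $\ell=3n$, $n=0,1,2,\dots$, are Laurent polynomials with integer coefficients, and the following hold. 1. The sequence $(f_v(\epsilon_v+3n))_{n\ge 0}$ has zero algebraic entropy: the degrees grow at most polynomially, that is, there is a $k$ such that for each variable $x_u$ the absolute values of the largest and of the smallest exponent of $x_u$ in $f_v(\epsilon_v+3n)$ are $O(n^k)$. 2. In fact the degrees grow at most quadratically (one can take $k=2$), and, unless $\mathbb{Z}A+\mathbb{Z}B$ is the whole lattice $\{w\in\mathbb{P}_0:\epsilon_w=0\}$ (that is, unless the torus has only three points), they grow exactly quadratically: for every $u\in\mathcal{T}(A,B)$ there are constants $c,C>0$ such that, for all sufficiently large $n$, the degree $d_n$ of $f_v(\epsilon_v+3n)$ in $x_u$ (the largest exponent of $x_u$) satisfies $c\,n^2\le d_n\le C\,n^2$. -/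

import Mathlib

namespace CubeRecurrence

/-- The triangular lattice `ℙ₀ = {(i, j, k) ∈ ℤ³ | i + j + k = 0}`. -/
def P₀ : AddSubgroup (ℤ × ℤ × ℤ) where
  carrier := {v | v.1 + v.2.1 + v.2.2 = 0}
  zero_mem' := by simp
  add_mem' := by
    intro a b ha hb
    simp only [Set.mem_ofPred_eq, Prod.fst_add, Prod.snd_add] at *
    linarith
  neg_mem' := by
    intro a ha
    simp only [Set.mem_ofPred_eq, Prod.fst_neg, Prod.snd_neg] at *
    linarith

def e₁₂ : P₀ := ⟨(1, -1, 0), by simp [P₀]⟩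
def e₂₃ : P₀ := ⟨(0, 1, -1), by simp [P₀]⟩
def e₃₁ : P₀ := ⟨(-1, 0, 1), by simp [P₀]⟩

/-- The color `ε_v ∈ {0, 1, 2}` of `v = (i, j, k)`, with `ε_v ≡ j - k` modulo `3`. -/
def color (v : P₀) : ℤ := (v.1.2.1 - v.1.2.2) % 3

/-- The cube recurrence with initial values `x`. Only the values `f v t` with
`t ≡ ε_v (mod 3)` are meaningful, and only they are constrained. -/
structure IsCubeRecurrence {K : Type*} [Field K] (x : P₀ → K) (f : P₀ → ℤ → K) : Prop where
  initial : ∀ v, f v (color v) = x v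
  step : ∀ (v : P₀) (t : ℤ), t ≡ color v [ZMOD 3] →
    f v (t + 3) * f v t =
      f (v + e₁₂) (t + 2) * f (v - e₁₂) (t + 1) +
      f (v + e₂₃) (t + 2) * f (v - e₂₃) (t + 1) +
      f (v + e₃₁) (t + 2) * f (v - e₃₁) (t + 1)

/-- The torus `ℙ₀ / (ℤA + ℤB)`. -/
abbrev Torus (A B : P₀) : Type := P₀ ⧸ AddSubgroup.closure ({A, B} : Set P₀)

/-- The field of rational functions in variables indexed by `T`. -/
abbrev RatFun (T : Type) : Type := FractionRing (MvPolynomial T ℤ)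

/-- The variable `x_u` as a rational function. -/
noncomputable def var {T : Type} (u : T) : RatFun T :=
  algebraMap (MvPolynomial T ℤ) (RatFun T) (MvPolynomial.X u)

/-- The initial values of the recurrence in the torus: one variable for each point of the torus,
so that `x_v = x_{v+A} = x_{v+B}`. -/
noncomputable def torusInit (A B : P₀) (v : P₀) : RatFun (Torus A B) :=
  var (QuotientAddGroup.mk v : Torus A B)

/-- Running the recurrence by solving for its newest term: forward in time for `σ = 1`, and
backward in time for `σ = -1`. -/
noncomputable def evolve {K : Type*} [Field K] (x : P₀ → K) (σ : ℤ) : ℕ → P₀ → K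
  | 0 => x
  | 1 => x
  | 2 => x
  | t + 3 => fun v =>
      (evolve x σ (t + 2) (v + σ • e₁₂) * evolve x σ (t + 1) (v - σ • e₁₂) +
       evolve x σ (t + 2) (v + σ • e₂₃) * evolve x σ (t + 1) (v - σ • e₂₃) +
       evolve x σ (t + 2) (v + σ • e₃₁) * evolve x σ (t + 1) (v - σ • e₃₁)) / evolve x σ t v

/-- The cube recurrence in the torus. By `isCubeRecurrence_torusCube` and `torusCube_unique` it is
the one and only solution with initial values `torusInit A B`
(as far as the meaningful values, those with `t ≡ ε_v (mod 3)`, are concerned). -/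
noncomputable def torusCube (A B : P₀) (v : P₀) (t : ℤ) : RatFun (Torus A B) :=
  if 0 ≤ t then evolve (torusInit A B) 1 t.toNat v
  else evolve (torusInit A B) (-1) (2 - t).toNat v

/-- Quotients of polynomials that are positive at `(1, 1, …)`. -/
def PosAtOne {T : Type} (a : RatFun T) : Prop :=
  ∃ p q : MvPolynomial T ℤ, 0 < MvPolynomial.eval (fun _ => 1) p ∧
    0 < MvPolynomial.eval (fun _ => 1) q ∧
    a = algebraMap _ (RatFun T) p / algebraMap _ (RatFun T) q

theorem algebraMap_ne_zero_of_pos {T : Type} {p : MvPolynomial T ℤ}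
    (hp : 0 < MvPolynomial.eval (fun _ => 1) p) : algebraMap _ (RatFun T) p ≠ 0 := by
  intro h
  have h0 : p = 0 := (IsFractionRing.injective (MvPolynomial T ℤ) (RatFun T)) (by simpa using h)
  simp [h0] at hp

theorem PosAtOne.ne_zero {T : Type} {a : RatFun T} (ha : PosAtOne a) : a ≠ 0 := by
  obtain ⟨p, q, hp, hq, rfl⟩ := ha
  exact div_ne_zero (algebraMap_ne_zero_of_pos hp) (algebraMap_ne_zero_of_pos hq)

theorem PosAtOne.add {T : Type} {a b : RatFun T} (ha : PosAtOne a) (hb : PosAtOne b) :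
    PosAtOne (a + b) := by
  obtain ⟨p, q, hp, hq, rfl⟩ := ha
  obtain ⟨r, s, hr, hs, rfl⟩ := hb
  have h1 := algebraMap_ne_zero_of_pos hq
  have h2 := algebraMap_ne_zero_of_pos hs
  refine ⟨p * s + q * r, q * s, ?_, ?_, ?_⟩
  · simp only [map_add, map_mul]; positivity
  · simp only [map_mul]; positivity
  · simp only [map_add, map_mul]; field_simp

theorem PosAtOne.mul {T : Type} {a b : RatFun T} (ha : PosAtOne a) (hb : PosAtOne b) :
    PosAtOne (a * b) := by
  obtain ⟨p, q, hp, hq, rfl⟩ := ha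
  obtain ⟨r, s, hr, hs, rfl⟩ := hb
  refine ⟨p * r, q * s, ?_, ?_, ?_⟩
  · simp only [map_mul]; positivity
  · simp only [map_mul]; positivity
  · simp only [map_mul]; rw [div_mul_div_comm]

theorem PosAtOne.div {T : Type} {a b : RatFun T} (ha : PosAtOne a) (hb : PosAtOne b) :
    PosAtOne (a / b) := by
  obtain ⟨r, s, hr, hs, rfl⟩ := hb
  rw [div_eq_mul_inv, inv_div]
  exact ha.mul ⟨s, r, hs, hr, rfl⟩

theorem posAtOne_torusInit (A B v : P₀) : PosAtOne (torusInit A B v) :=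
  ⟨MvPolynomial.X (QuotientAddGroup.mk v : Torus A B), 1, by simp, by simp,
    by simp [torusInit, var]⟩

theorem posAtOne_evolve (A B : P₀) (σ : ℤ) :
    ∀ (n : ℕ) (v : P₀), PosAtOne (evolve (torusInit A B) σ n v)
  | 0, v => posAtOne_torusInit A B v
  | 1, v => posAtOne_torusInit A B v
  | 2, v => posAtOne_torusInit A B v
  | t + 3, v => by
      have h2 := posAtOne_evolve A B σ (t + 2)
      have h1 := posAtOne_evolve A B σ (t + 1)
      have h0 := posAtOne_evolve A B σ t
      rw [evolve]
      exact ((((h2 _).mul (h1 _)).add ((h2 _).mul (h1 _))).add ((h2 _).mul (h1 _))).div (h0 _)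

theorem evolve_step (A B : P₀) (σ : ℤ) (t : ℕ) (v : P₀) :
    evolve (torusInit A B) σ (t + 3) v * evolve (torusInit A B) σ t v =
      evolve (torusInit A B) σ (t + 2) (v + σ • e₁₂) *
        evolve (torusInit A B) σ (t + 1) (v - σ • e₁₂) +
      evolve (torusInit A B) σ (t + 2) (v + σ • e₂₃) *
        evolve (torusInit A B) σ (t + 1) (v - σ • e₂₃) +
      evolve (torusInit A B) σ (t + 2) (v + σ • e₃₁) *
        evolve (torusInit A B) σ (t + 1) (v - σ • e₃₁) := by
  have h := (posAtOne_evolve A B σ t v).ne_zero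
  rw [evolve, div_mul_cancel₀ _ h]

theorem torusCube_of_nat (A B v : P₀) (n : ℕ) :
    torusCube A B v n = evolve (torusInit A B) 1 n v := by
  simp [torusCube]

theorem torusCube_two_sub (A B v : P₀) (n : ℕ) :
    torusCube A B v (2 - n) = evolve (torusInit A B) (-1) n v := by
  rcases n with _ | _ | _ | n
  · simp [torusCube, evolve]
  · simp [torusCube, evolve]
  · simp [torusCube, evolve]
  · have h : ¬ (0 : ℤ) ≤ 2 - ((n + 1 + 1 + 1 : ℕ) : ℤ) := by push_cast; omega
    rw [torusCube, if_neg h]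
    congr 1
    omega

theorem color_cases (v : P₀) : color v = 0 ∨ color v = 1 ∨ color v = 2 := by
  unfold color; omega

theorem color_add_e (v : P₀) :
    color (v + e₁₂) ≡ color v + 2 [ZMOD 3] ∧ color (v - e₁₂) ≡ color v + 1 [ZMOD 3] ∧
    color (v + e₂₃) ≡ color v + 2 [ZMOD 3] ∧ color (v - e₂₃) ≡ color v + 1 [ZMOD 3] ∧
    color (v + e₃₁) ≡ color v + 2 [ZMOD 3] ∧ color (v - e₃₁) ≡ color v + 1 [ZMOD 3] := by
  simp only [color, e₁₂, e₂₃, e₃₁, Int.ModEq, AddSubgroup.coe_add, AddSubgroup.coe_sub,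
    Prod.fst_add, Prod.snd_add, Prod.fst_sub, Prod.snd_sub]
  omega

/-- The constructed family satisfies the cube recurrence. -/
theorem isCubeRecurrence_torusCube (A B : P₀) :
    IsCubeRecurrence (torusInit A B) (torusCube A B) where
  initial v := by
    rcases color_cases v with h | h | h <;> rw [h] <;> simp [torusCube, evolve]
  step v t _ := by
    rcases le_or_gt 0 t with ht | ht
    · obtain ⟨n, rfl⟩ := Int.eq_ofNat_of_zero_le ht
      have h := evolve_step A B 1 n v
      simp only [one_smul, ← torusCube_of_nat] at h
      exact_mod_cast h
    · obtain ⟨n, rfl⟩ : ∃ n : ℕ, t = 2 - ((n + 3 : ℕ) : ℤ) := ⟨(-1 - t).toNat, by omega⟩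
      have h := evolve_step A B (-1) n v
      simp only [neg_smul, one_smul, sub_neg_eq_add, ← sub_eq_add_neg,
        ← torusCube_two_sub] at h
      have e3 : (2 - ((n + 3 : ℕ) : ℤ)) + 3 = 2 - (n : ℤ) := by push_cast; ring
      have e2 : (2 - ((n + 3 : ℕ) : ℤ)) + 2 = 2 - ((n + 1 : ℕ) : ℤ) := by push_cast; ring
      have e1 : (2 - ((n + 3 : ℕ) : ℤ)) + 1 = 2 - ((n + 2 : ℕ) : ℤ) := by push_cast; ring
      rw [e3, e2, e1, mul_comm, h]
      ring

theorem torusCube_ne_zero (A B v : P₀) (t : ℤ) : torusCube A B v t ≠ 0 := by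
  unfold torusCube
  split_ifs
  · exact (posAtOne_evolve A B _ _ _).ne_zero
  · exact (posAtOne_evolve A B _ _ _).ne_zero

/-- The cube recurrence in the torus has only one solution. -/
theorem torusCube_unique (A B : P₀) (f : P₀ → ℤ → RatFun (Torus A B))
    (hf : IsCubeRecurrence (torusInit A B) f) (v : P₀) (t : ℤ) (ht : t ≡ color v [ZMOD 3]) :
    f v t = torusCube A B v t := by
  have hT := isCubeRecurrence_torusCube A B
  have base : ∀ (w : P₀) (s : ℤ), s ≡ color w [ZMOD 3] → 0 ≤ s → s ≤ 2 →
      f w s = torusCube A B w s := by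
    intro w s hs h0 h2
    have : s = color w := by
      rcases color_cases w with h | h | h <;> rw [h] at hs ⊢ <;> unfold Int.ModEq at hs <;> omega
    rw [this, hf.initial, hT.initial]
  have key : ∀ n : ℕ, ∀ (w : P₀) (s : ℤ), s ≡ color w [ZMOD 3] → -n ≤ s → s ≤ n + 2 →
      f w s = torusCube A B w s := by
    intro n
    induction n with
    | zero => intro w s hs h0 h2; exact base w s hs (by simpa using h0) (by simpa using h2)
    | succ n ih =>
      intro w s hs h0 h2
      push_cast at h0 h2
      obtain ⟨c1, c2, c3, c4, c5, c6⟩ := color_add_e w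
      by_cases hlo : s = -(n : ℤ) - 1
      · have hf' := hf.step w s hs
        have hT' := hT.step w s hs
        unfold Int.ModEq at hs c1 c2 c3 c4 c5 c6
        have ih' : ∀ (w : P₀) (s : ℤ), s % 3 = color w % 3 → -n ≤ s → s ≤ n + 2 →
          f w s = torusCube A B w s := ih
        rw [ih' (w + e₁₂) (s + 2) (by omega) (by omega) (by omega),
          ih' (w - e₁₂) (s + 1) (by omega) (by omega) (by omega),
          ih' (w + e₂₃) (s + 2) (by omega) (by omega) (by omega),
          ih' (w - e₂₃) (s + 1) (by omega) (by omega) (by omega),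
          ih' (w + e₃₁) (s + 2) (by omega) (by omega) (by omega),
          ih' (w - e₃₁) (s + 1) (by omega) (by omega) (by omega),
          ih' w (s + 3) (by omega) (by omega) (by omega), ← hT'] at hf'
        exact mul_left_cancel₀ (torusCube_ne_zero A B w (s + 3)) hf'
      by_cases hhi : s = n + 3
      · obtain ⟨r, rfl⟩ : ∃ r, s = r + 3 := ⟨s - 3, by ring⟩
        have hr : r ≡ color w [ZMOD 3] := by unfold Int.ModEq at hs ⊢; omega
        have hf' := hf.step w r hr
        have hT' := hT.step w r hr
        unfold Int.ModEq at hs c1 c2 c3 c4 c5 c6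
        have ih' : ∀ (w : P₀) (s : ℤ), s % 3 = color w % 3 → -n ≤ s → s ≤ n + 2 →
          f w s = torusCube A B w s := ih
        rw [ih' (w + e₁₂) (r + 2) (by omega) (by omega) (by omega),
          ih' (w - e₁₂) (r + 1) (by omega) (by omega) (by omega),
          ih' (w + e₂₃) (r + 2) (by omega) (by omega) (by omega),
          ih' (w - e₂₃) (r + 1) (by omega) (by omega) (by omega),
          ih' (w + e₃₁) (r + 2) (by omega) (by omega) (by omega),
          ih' (w - e₃₁) (r + 1) (by omega) (by omega) (by omega),
          ih' w r (by omega) (by omega) (by omega), ← hT'] at hf'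
        exact mul_right_cancel₀ (torusCube_ne_zero A B w r) hf'
      · exact ih w s hs (by omega) (by omega)
  exact key t.natAbs v t ht (by omega) (by omega)

/-- Laurent polynomials with integer coefficients in variables indexed by `T`: finite integer
combinations of exponent vectors `m : T →₀ ℤ`. -/
abbrev LaurentPoly (T : Type) : Type := AddMonoidAlgebra ℤ (T →₀ ℤ)

/-- A Laurent polynomial as a rational function. -/
noncomputable def LaurentPoly.toRatFun {T : Type} (p : LaurentPoly T) : RatFun T :=
  p.coeff.sum fun m c => (c : RatFun T) * m.prod fun u k => var u ^ k

/-- The degree of a nonzero Laurent polynomial in `x_u`: the largest exponent of `x_u`. -/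
noncomputable def degreeIn {T : Type} (u : T) (p : LaurentPoly T) : ℤ :=
  sSup ((fun m : T →₀ ℤ => m u) '' (p.coeff.support : Set (T →₀ ℤ)))

/-- The smallest exponent of `x_u` in a nonzero Laurent polynomial. -/
noncomputable def lowDegreeIn {T : Type} (u : T) (p : LaurentPoly T) : ℤ :=
  sInf ((fun m : T →₀ ℤ => m u) '' (p.coeff.support : Set (T →₀ ℤ)))

/-- For every variable, the largest and the smallest exponent of this variable in `p n` are
`O(n ^ k)`. -/
def DegreesBigO {T : Type} (p : ℕ → LaurentPoly T) (k : ℕ) : Prop :=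
  ∀ u : T, ∃ C : ℝ, ∀ᶠ n : ℕ in Filter.atTop,
    |(degreeIn u (p n) : ℝ)| ≤ C * (n : ℝ) ^ k ∧ |(lowDegreeIn u (p n) : ℝ)| ≤ C * (n : ℝ) ^ k

/-- Zero algebraic entropy: the degrees grow at most polynomially. -/
def ZeroAlgebraicEntropy {T : Type} (p : ℕ → LaurentPoly T) : Prop :=
  ∃ k : ℕ, DegreesBigO p k

/-- The sequence `d` grows quadratically: it lies eventually between two positive multiples
of `n ^ 2`. -/
def GrowsQuadratically (d : ℕ → ℤ) : Prop :=
  ∃ c C : ℝ, 0 < c ∧ 0 < C ∧ ∀ᶠ n : ℕ in Filter.atTop,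
    c * (n : ℝ) ^ 2 ≤ (d n : ℝ) ∧ (d n : ℝ) ≤ C * (n : ℝ) ^ 2

end CubeRecurrence

/-! ### The recurrence on `ℤ³` near its initial levels, and solutions that vanish on level `3` -/

namespace CubeRecurrence

open MvPolynomial

/-! Along the projection `proj : ℤ³ → ℙ₀` with kernel generated by `(1, 1, 1)`, and with time equal
to the level `a + b + c`, the recurrence becomes the cube recurrence on `ℤ³` with initial values on
the levels `0, 1, 2`. Laurentness and exponent bounds are proved there with independent variables
and then pushed down to the torus by identifying variables.

Laurent phenomenon (`isLaurentAt`), by induction on the level. A value is Laurent in the levels `1,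
2, 3`, so its denominator is a monomial times irreducible numerators `cubeNum` of level `3`. It is
also Laurent in the levels `4, 5, 6`, which gives a denominator built from numerators of these
levels. No `cubeNum` divides the latter: some solution over `ZMod 5` has a zero at the given place
of level `3` but none on the levels `4, 5, 6`. This uses a formula for level `6` that divides by
level `2` only. By unique factorization just a monomial remains as denominator.

Upper bound. The recurrence has no minus signs, so on positive data `c u * s ^ ω u` the orders of
growth in `s` obey the tropical (max-plus) recurrence (`isTheta_of_isTrop`). Such orders bound the
weights of all exponents from above (`weight_le_of_evalAt_le`). For `ω = ±δ` at one point the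
tropical evolution is explicit, bounded by `4` and supported in an octant. So each variable of `ℤ³`
has exponent at most `4` in absolute value, and only quadratically many variables occur
(`exponent_bound`, `card_le`). Summing over the points above one point of the torus gives the
quadratic bound.

Lower bound. Let `D` be the tropical evolution of `δ_u` on the torus. A maximum is at least the mean
of its three terms, so the sum of `D` over the torus is convex in steps of two. The convexity is
strict unless two consecutive times are flat, that is, all three terms agree everywhere. Flatness
propagates backward (`IsFlat.prev`), and the initial data are not flat unless the three directions
coincide in the torus, which then has three points. Hence the sum grows quadratically. Values of one
color differ by a bounded amount up to a bounded delay (`le_add_steps`, `exists_steps`), so every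
single value grows quadratically, and so does the degree in `x_u`. -/

/-- A solution of the cube recurrence on the part `0 ≤ a + b + c` of `ℤ³`. -/
structure IsSol {K : Type} [Field K] (F : ℤ → ℤ → ℤ → K) : Prop where
  ne_zero : ∀ a b c, 0 ≤ a + b + c → F a b c ≠ 0
  step : ∀ a b c, 0 ≤ a + b + c → F (a + 1) (b + 1) (c + 1) * F a b c =
    F a (b + 1) (c + 1) * F (a + 1) b c + F (a + 1) b (c + 1) * F a (b + 1) c +
      F (a + 1) (b + 1) c * F a b (c + 1)

/-- A solution of the cube recurrence on the levels `0, …, 6` that may vanish on the levels `≥ 3`;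
the level `6` is determined by a formula that divides by values on level `2` only. -/
structure IsRegularSol {K : Type} [Field K] (F : ℤ → ℤ → ℤ → K) : Prop where
  ne_zero : ∀ a b c, 0 ≤ a + b + c → a + b + c ≤ 2 → F a b c ≠ 0
  step : ∀ a b c, 0 ≤ a + b + c → a + b + c ≤ 2 → F (a + 1) (b + 1) (c + 1) * F a b c =
    F a (b + 1) (c + 1) * F (a + 1) b c + F (a + 1) b (c + 1) * F a (b + 1) c +
      F (a + 1) (b + 1) c * F a b (c + 1)
  six : ∀ a b c, a + b + c = 3 → F (a + 1) (b + 1) (c + 1) *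
      (F (a - 1) b c * F a (b - 1) c * F a b (c - 1)) =
    F (a + 1) b c * F a (b + 1) c * F a b (c + 1) * F (a - 1) (b - 1) (c - 1) +
    F (a + 1) b c * F a (b - 1) c * F a b (c - 1) * F (a - 1) (b + 1) (c + 1) +
    F a (b + 1) c * F (a - 1) b c * F a b (c - 1) * F (a + 1) (b - 1) (c + 1) +
    F a b (c + 1) * F (a - 1) b c * F a (b - 1) c * F (a + 1) (b + 1) (c - 1) -
    F a (b + 1) c * F a b (c + 1) * F (a - 1) b c * F (a + 1) (b - 1) (c - 1) -
    F (a + 1) b c * F a b (c + 1) * F a (b - 1) c * F (a - 1) (b + 1) (c - 1) -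
    F (a + 1) b c * F a (b + 1) c * F a b (c - 1) * F (a - 1) (b - 1) (c + 1)

/-- The point is the formula `six`: it contains no value of the levels `1`, `3`, `5`, so it can
survive a zero on level `3`. -/
theorem IsSol.isRegularSol {K : Type} [Field K] {F : ℤ → ℤ → ℤ → K} (h : IsSol F) :
    IsRegularSol F where
  ne_zero a b c h0 _ := h.ne_zero a b c h0
  step a b c h0 _ := h.step a b c h0
  six a b c h3 := by
    have hr := h.step a b c (by omega)
    have s1 := h.step (a - 1) b c (by omega)
    have s2 := h.step a (b - 1) c (by omega)
    have s3 := h.step a b (c - 1) (by omega)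
    have t1 := h.step a (b - 1) (c - 1) (by omega)
    have t2 := h.step (a - 1) b (c - 1) (by omega)
    have t3 := h.step (a - 1) (b - 1) c (by omega)
    have z := h.step (a - 1) (b - 1) (c - 1) (by omega)
    simp only [sub_add_cancel] at s1 s2 s3 t1 t2 t3 z
    -- After multiplication by the central value `F a b c`, the recurrences at the seven
    -- neighbouring cubes eliminate the other values of the levels `1`, `3`, `5`, and every
    -- remaining term has the factor `F a b c`.
    apply mul_right_cancel₀ (h.ne_zero a b c (by omega))
    generalize F a b c = ρ at *
    generalize F (a + 1) b c = T1 at *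
    generalize F a (b + 1) c = T2 at *
    generalize F a b (c + 1) = T3 at *
    generalize F (a - 1) b c = A1 at *
    generalize F a (b - 1) c = A2 at *
    generalize F a b (c - 1) = A3 at *
    linear_combination A1 * A2 * A3 * hr + A2 * A3 * T1 * s1 + A1 * A3 * T2 * s2 +
      A1 * A2 * T3 * s3 - T2 * T3 * A1 * t1 - T1 * T3 * A2 * t2 - T1 * T2 * A3 * t3 -
      T1 * T2 * T3 * z

/-- Evaluation of integer polynomials at a point of a field. -/
noncomputable def evalAt {σ K : Type} [Field K] (x : σ → K) : MvPolynomial σ ℤ →+* K :=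
  eval₂Hom (Int.castRingHom K) x

@[simp]
theorem evalAt_X {σ K : Type} [Field K] (x : σ → K) (w : σ) : evalAt x (X w) = x w :=
  eval₂_X _ _ _

@[simp]
theorem evalAt_monomial {σ K : Type} [Field K] (x : σ → K) (m : σ →₀ ℕ) (n : ℤ) :
    evalAt x (monomial m n) = n * m.prod fun w k => x w ^ k :=
  eval₂_monomial _ _

/-- `x` extends the initial values of `F` by nonzero values. -/
structure IsInit {K : Type} [Field K] (F : ℤ → ℤ → ℤ → K) (x : ℤ × ℤ × ℤ → K) : Prop where
  eq : ∀ a b c, 0 ≤ a + b + c → a + b + c ≤ 2 → x (a, b, c) = F a b c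
  ne_zero : ∀ w, x w ≠ 0

/-- The function `Φ` of regular solutions is a Laurent polynomial in the initial values. -/
def IsLaurent (Φ : ∀ (K : Type) [Field K], (ℤ → ℤ → ℤ → K) → K) : Prop :=
  ∃ (p : MvPolynomial (ℤ × ℤ × ℤ) ℤ) (m : ℤ × ℤ × ℤ →₀ ℕ), ∀ (K : Type) [Field K]
    (F : ℤ → ℤ → ℤ → K) (x : ℤ × ℤ × ℤ → K), IsRegularSol F → IsInit F x →
    Φ K F * evalAt x (monomial m (1 : ℤ)) = evalAt x p

theorem evalAt_monomial_ne_zero {σ K : Type} [Field K] {x : σ → K} (hx : ∀ w, x w ≠ 0)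
    (m : σ →₀ ℕ) : evalAt x (monomial m (1 : ℤ)) ≠ 0 := by
  rw [evalAt_monomial, Int.cast_one, one_mul]
  exact Finset.prod_ne_zero_iff.mpr fun i _ => pow_ne_zero _ (hx i)

theorem monomial_add_one {σ : Type} (m n : σ →₀ ℕ) :
    monomial (m + n) (1 : ℤ) = monomial m 1 * monomial n 1 := by
  rw [monomial_mul, one_mul]

namespace IsLaurent

variable {Φ Ψ : ∀ (K : Type) [Field K], (ℤ → ℤ → ℤ → K) → K}

theorem coord (a b c : ℤ) (h0 : 0 ≤ a + b + c) (h2 : a + b + c ≤ 2) :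
    IsLaurent fun _ _ F => F a b c :=
  ⟨X (a, b, c), 0, fun K _ F x _ hx => by simp [hx.eq a b c h0 h2]⟩

theorem add (h : IsLaurent Φ) (h' : IsLaurent Ψ) : IsLaurent fun K _ F => Φ K F + Ψ K F := by
  obtain ⟨p, m, hp⟩ := h
  obtain ⟨q, n, hq⟩ := h'
  refine ⟨p * monomial n 1 + q * monomial m 1, m + n, fun K _ F x hF hx => ?_⟩
  rw [monomial_add_one, map_add, map_mul, map_mul, map_mul, ← hp K F x hF hx, ← hq K F x hF hx]
  ring

theorem mul (h : IsLaurent Φ) (h' : IsLaurent Ψ) : IsLaurent fun K _ F => Φ K F * Ψ K F := by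
  obtain ⟨p, m, hp⟩ := h
  obtain ⟨q, n, hq⟩ := h'
  refine ⟨p * q, m + n, fun K _ F x hF hx => ?_⟩
  rw [monomial_add_one, map_mul, map_mul, ← hp K F x hF hx, ← hq K F x hF hx]
  ring

theorem sub (h : IsLaurent Φ) (h' : IsLaurent Ψ) : IsLaurent fun K _ F => Φ K F - Ψ K F := by
  obtain ⟨p, m, hp⟩ := h
  obtain ⟨q, n, hq⟩ := h'
  refine ⟨p * monomial n 1 - q * monomial m 1, m + n, fun K _ F x hF hx => ?_⟩
  rw [monomial_add_one, map_sub, map_mul, map_mul, map_mul, ← hp K F x hF hx, ← hq K F x hF hx]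
  ring

theorem of_mul_coord (a b c : ℤ) (h0 : 0 ≤ a + b + c) (h2 : a + b + c ≤ 2) (h : IsLaurent Ψ)
    (hΦ : ∀ (K : Type) [Field K] (F : ℤ → ℤ → ℤ → K), IsRegularSol F →
      Φ K F * F a b c = Ψ K F) : IsLaurent Φ := by
  obtain ⟨p, m, hp⟩ := h
  refine ⟨p, m + Finsupp.single (a, b, c) 1, fun K _ F x hF hx => ?_⟩
  have hX : monomial (Finsupp.single (a, b, c) 1) (1 : ℤ) = X (a, b, c) := rfl
  rw [monomial_add_one, map_mul, ← hp K F x hF hx, ← hΦ K F hF, ← hx.eq a b c h0 h2, hX, evalAt_X]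
  ring

theorem of_step (a b c : ℤ) (h0 : 0 ≤ a + b + c) (h2 : a + b + c ≤ 2)
    (h : ∀ a' b' c' : ℤ, a + b + c < a' + b' + c' → a' + b' + c' < a + b + c + 3 →
      IsLaurent fun _ _ F => F a' b' c') :
    IsLaurent fun _ _ F => F (a + 1) (b + 1) (c + 1) := by
  refine of_mul_coord a b c h0 h2 ?_ fun K _ F hF => hF.step a b c h0 h2
  exact (((h _ _ _ (by omega) (by omega)).mul (h _ _ _ (by omega) (by omega))).add
    ((h _ _ _ (by omega) (by omega)).mul (h _ _ _ (by omega) (by omega)))).add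
    ((h _ _ _ (by omega) (by omega)).mul (h _ _ _ (by omega) (by omega)))

/-- The bottom of a cube with top on level `3`, `4` or `5` is on level `0`, `1` or `2`, so only
initial values are divided by. -/
theorem le_five (n : ℕ) (hn : n ≤ 5) :
    ∀ a b c : ℤ, a + b + c = n → IsLaurent fun _ _ F => F a b c := by
  induction n using Nat.strong_induction_on with
  | _ n ih =>
    intro a b c h
    rcases le_or_gt n 2 with h2 | h2
    · exact coord a b c (by omega) (by omega)
    · have := of_step (a - 1) (b - 1) (c - 1) (by omega) (by omega) fun a' b' c' h1 h3 =>
        ih (a' + b' + c').toNat (by omega) (by omega) a' b' c' (by omega)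
      simpa only [sub_add_cancel] using this

/-- The step from level `3` would divide by a value that is not a monomial. The formula `six`
divides by three initial values instead, removed here one by one. -/
theorem eq_six (a b c : ℤ) (h : a + b + c = 3) :
    IsLaurent fun _ _ F => F (a + 1) (b + 1) (c + 1) := by
  have L : ∀ a b c : ℤ, 0 ≤ a + b + c → a + b + c ≤ 5 → IsLaurent fun _ _ F => F a b c :=
    fun a b c h0 h5 => le_five (a + b + c).toNat (by omega) a b c (by omega)
  refine of_mul_coord (Φ := fun K _ F => F (a + 1) (b + 1) (c + 1)) (a - 1) b c (by omega)
    (by omega) ?_ fun K _ F hF => rfl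
  refine of_mul_coord a (b - 1) c (by omega) (by omega) ?_ fun K _ F hF => rfl
  refine of_mul_coord a b (c - 1) (by omega) (by omega) ?_ fun K _ F hF =>
    Eq.trans (by ring) (hF.six a b c h)
  refine ((((((?_ : IsLaurent _).add ?_).add ?_).add ?_).sub ?_).sub ?_).sub ?_ <;>
  exact (((L _ _ _ (by omega) (by omega)).mul (L _ _ _ (by omega) (by omega))).mul
    (L _ _ _ (by omega) (by omega))).mul (L _ _ _ (by omega) (by omega))

theorem le_six (a b c : ℤ) (h0 : 0 ≤ a + b + c) (h6 : a + b + c ≤ 6) :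
    IsLaurent fun _ _ F => F a b c := by
  rcases le_or_gt (a + b + c) 5 with h5 | h5
  · exact le_five (a + b + c).toNat (by omega) a b c (by omega)
  · have := eq_six (a - 1) (b - 1) (c - 1) (by omega)
    simpa only [sub_add_cancel] using this

end IsLaurent

/-- The numerator of the value at the top of the cube with bottom `(a, b, c)`. -/
noncomputable def cubeNum (a b c : ℤ) : MvPolynomial (ℤ × ℤ × ℤ) ℤ :=
  X (a, b + 1, c + 1) * X (a + 1, b, c) + X (a + 1, b, c + 1) * X (a, b + 1, c) +
    X (a + 1, b + 1, c) * X (a, b, c + 1)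

/-- The polynomial is linear in `X (a + 1, b, c)`, and its leading coefficient, a variable, is prime
to its constant term. -/
theorem irreducible_cubeNum (a b c : ℤ) : Irreducible (cubeNum a b c) := by
  have := irreducible_mul_X_add (X (a, b + 1, c + 1) : MvPolynomial (ℤ × ℤ × ℤ) ℤ)
    (X (a + 1, b, c + 1) * X (a, b + 1, c) + X (a + 1, b + 1, c) * X (a, b, c + 1))
    (a + 1, b, c) (X_ne_zero _) (by simp) ?_ ?_
  · rwa [← add_assoc] at this
  · classical
    intro h
    rcases Finset.mem_union.mp (vars_add_subset _ _ h) with h | h <;>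
    rcases Finset.mem_union.mp (vars_mul _ _ h) with h | h <;> simp at h
  · refine (Irreducible.isRelPrime_iff_not_dvd X_prime.irreducible).mpr ?_
    rintro ⟨g, hg⟩
    -- Putting this variable to `0` and all others to `1` turns the constant term into `2` and its
    -- alleged multiple into `0`.
    have := congrArg (eval fun w : ℤ × ℤ × ℤ => if w = (a, b + 1, c + 1) then (0 : ℤ) else 1) hg
    simp at this

/-- A regular solution over `ZMod 5` that depends on the level and the parity of `a` only. -/
def testSol (a b c : ℤ) : ZMod 5 :=
  if a + b + c = 1 then (if a % 2 = 0 then 2 else 1)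
  else if a + b + c = 3 then (if a % 2 = 0 then 4 else 0)
  else if a + b + c = 4 then (if a % 2 = 0 then 3 else 2)
  else if a + b + c = 5 then (if a % 2 = 0 then 3 else 1)
  else if a + b + c = 6 then (if a % 2 = 0 then 2 else 3)
  else 1

instance : Fact (Nat.Prime 5) := ⟨by norm_num⟩

theorem testSol_ne_zero (a b c : ℤ) (h : a + b + c ≠ 3) : testSol a b c ≠ 0 := by
  unfold testSol
  rw [if_neg h]
  split_ifs <;> decide

theorem testSol_eq (a b c : ℤ) (t : ℕ) (i : ℤ) (ht : a + b + c = t) (hi : a % 2 = i) :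
    testSol a b c = if t = 1 then (if i = 0 then 2 else 1)
      else if t = 3 then (if i = 0 then 4 else 0)
      else if t = 4 then (if i = 0 then 3 else 2)
      else if t = 5 then (if i = 0 then 3 else 1)
      else if t = 6 then (if i = 0 then 2 else 3)
      else 1 := by
  unfold testSol
  rw [ht, hi]
  norm_cast

theorem isRegularSol_testSol : IsRegularSol testSol where
  ne_zero a b c _ _ := testSol_ne_zero a b c (by omega)
  step a b c h0 h2 := by
    obtain ⟨t, ht⟩ := Int.eq_ofNat_of_zero_le h0
    have ht2 : t ≤ 2 := by omega
    rcases Int.emod_two_eq_zero_or_one a with hi | hi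
    · rw [testSol_eq (a + 1) (b + 1) (c + 1) (t + 3) 1 (by omega) (by omega),
        testSol_eq a b c t 0 (by omega) (by omega),
        testSol_eq a (b + 1) (c + 1) (t + 2) 0 (by omega) (by omega),
        testSol_eq (a + 1) b c (t + 1) 1 (by omega) (by omega),
        testSol_eq (a + 1) b (c + 1) (t + 2) 1 (by omega) (by omega),
        testSol_eq a (b + 1) c (t + 1) 0 (by omega) (by omega),
        testSol_eq (a + 1) (b + 1) c (t + 2) 1 (by omega) (by omega),
        testSol_eq a b (c + 1) (t + 1) 0 (by omega) (by omega)]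
      interval_cases t <;> decide
    · rw [testSol_eq (a + 1) (b + 1) (c + 1) (t + 3) 0 (by omega) (by omega),
        testSol_eq a b c t 1 (by omega) (by omega),
        testSol_eq a (b + 1) (c + 1) (t + 2) 1 (by omega) (by omega),
        testSol_eq (a + 1) b c (t + 1) 0 (by omega) (by omega),
        testSol_eq (a + 1) b (c + 1) (t + 2) 0 (by omega) (by omega),
        testSol_eq a (b + 1) c (t + 1) 1 (by omega) (by omega),
        testSol_eq (a + 1) (b + 1) c (t + 2) 0 (by omega) (by omega),
        testSol_eq a b (c + 1) (t + 1) 1 (by omega) (by omega)]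
      interval_cases t <;> decide
  six a b c h := by
    obtain ⟨i, j, hi, hi', hj, hij⟩ : ∃ i j : ℤ, a % 2 = i ∧ (a + 1) % 2 = j ∧ (a - 1) % 2 = j ∧
        (i = 0 ∧ j = 1 ∨ i = 1 ∧ j = 0) := ⟨a % 2, (a + 1) % 2, rfl, rfl, by omega, by omega⟩
    rw [testSol_eq (a + 1) (b + 1) (c + 1) 6 j (by omega) hi',
      testSol_eq (a - 1) b c 2 j (by omega) hj, testSol_eq a (b - 1) c 2 i (by omega) hi,
      testSol_eq a b (c - 1) 2 i (by omega) hi, testSol_eq (a + 1) b c 4 j (by omega) hi',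
      testSol_eq a (b + 1) c 4 i (by omega) hi, testSol_eq a b (c + 1) 4 i (by omega) hi,
      testSol_eq (a - 1) (b - 1) (c - 1) 0 j (by omega) hj,
      testSol_eq (a - 1) (b + 1) (c + 1) 4 j (by omega) hj,
      testSol_eq (a + 1) (b - 1) (c + 1) 4 j (by omega) hi',
      testSol_eq (a + 1) (b + 1) (c - 1) 4 j (by omega) hi',
      testSol_eq (a + 1) (b - 1) (c - 1) 2 j (by omega) hi',
      testSol_eq (a - 1) (b + 1) (c - 1) 2 j (by omega) hj,
      testSol_eq (a - 1) (b - 1) (c + 1) 2 j (by omega) hj]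
    rcases hij with ⟨rfl, rfl⟩ | ⟨rfl, rfl⟩ <;> decide

/-- For every cube on level `0` there is a regular solution that vanishes at its top, but not on
the levels `4`, `5` and `6`. -/
theorem exists_isRegularSol_vanishing (a b c : ℤ) (h : a + b + c = 0) :
    ∃ (F : ℤ → ℤ → ℤ → ZMod 5) (x : ℤ × ℤ × ℤ → ZMod 5), IsRegularSol F ∧ IsInit F x ∧
      (∀ a b c, a + b + c ≠ 3 → F a b c ≠ 0) ∧ evalAt x (cubeNum a b c) = 0 := by
  have key : ∀ F : ℤ → ℤ → ℤ → ZMod 5, IsRegularSol F → (∀ a b c, a + b + c ≠ 3 → F a b c ≠ 0) →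
      F (a + 1) (b + 1) (c + 1) = 0 → ∃ (F : ℤ → ℤ → ℤ → ZMod 5) (x : ℤ × ℤ × ℤ → ZMod 5),
      IsRegularSol F ∧ IsInit F x ∧
      (∀ a b c, a + b + c ≠ 3 → F a b c ≠ 0) ∧ evalAt x (cubeNum a b c) = 0 := by
    intro F hF h0 hr
    -- Off the initial levels `x` only has to be nonzero, hence the value `1` on level `3`, where
    -- `F` has zeros.
    refine ⟨F, fun w => if w.1 + w.2.1 + w.2.2 = 3 then 1 else F w.1 w.2.1 w.2.2, hF,
      ⟨fun a b c _ _ => if_neg (by dsimp only; omega), fun w => ?_⟩, h0, ?_⟩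
    · split_ifs with h
      · exact one_ne_zero
      · exact h0 _ _ _ h
    · have := hF.step a b c (by omega) (by omega)
      rw [hr, zero_mul] at this
      simp only [cubeNum, map_add, map_mul, evalAt_X]
      rw [if_neg (by omega), if_neg (by omega), if_neg (by omega), if_neg (by omega),
        if_neg (by omega), if_neg (by omega), this]
  rcases Int.emod_two_eq_zero_or_one a with hi | hi
  · exact key _ isRegularSol_testSol testSol_ne_zero
      (by rw [testSol_eq _ _ _ 3 1 (by omega) (by omega)]; decide)
  -- `testSol` vanishes on level `3` at odd first coordinates. A translation by `(-1, 1, 0)` keeps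
  -- the level and changes the parity.
  · refine key (fun a b c => testSol (a - 1) (b + 1) c) ⟨fun a b c _ _ => ?_, fun a b c h0 h2 => ?_,
      fun a b c h => ?_⟩ (fun a b c h => testSol_ne_zero _ _ _ (by omega))
      (by rw [testSol_eq _ _ _ 3 1 (by omega) (by omega)]; decide)
    · exact testSol_ne_zero _ _ _ (by omega)
    · have := isRegularSol_testSol.step (a - 1) (b + 1) c (by omega) (by omega)
      simpa only [sub_add_cancel, add_sub_cancel_right] using this
    · have := isRegularSol_testSol.six (a - 1) (b + 1) c (by omega)
      simpa only [sub_add_cancel, add_sub_cancel_right] using this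

end CubeRecurrence

/-! ### Passage from `ℙ₀` to `ℤ³`, and denominators under a change of initial levels -/

namespace CubeRecurrence

open MvPolynomial

/-- The projection `ℤ³ → ℙ₀` along `(1, 1, 1)` under which the cube recurrence on `ℤ³` becomes the
cube recurrence on `ℙ₀`, time being `a + b + c`. -/
def proj (a b c : ℤ) : P₀ := ⟨(c - a, a - b, b - c), by simp [P₀]⟩

/-- The section of `proj` with values on the levels `0, 1, 2`. -/
def lift (v : P₀) : ℤ × ℤ × ℤ :=
  (-((v.1.1 - v.1.2.1) / 3), -((v.1.1 - v.1.2.1) / 3) - v.1.2.1, -((v.1.1 - v.1.2.1) / 3) + v.1.1)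

theorem lift_proj (a b c : ℤ) (h0 : 0 ≤ a + b + c) (h2 : a + b + c ≤ 2) :
    lift (proj a b c) = (a, b, c) := by
  simp only [lift, proj, Prod.mk.injEq]
  omega

theorem proj_add_e₁₂ (a b c : ℤ) : proj (a + 1) (b + 1) (c + 1) + (1 : ℤ) • e₁₂ =
    proj a (b + 1) (c + 1) := by
  rw [one_smul]
  ext <;> simp [proj, e₁₂] <;> ring

theorem proj_add_e₂₃ (a b c : ℤ) : proj (a + 1) (b + 1) (c + 1) + (1 : ℤ) • e₂₃ =
    proj (a + 1) b (c + 1) := by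
  rw [one_smul]
  ext <;> simp [proj, e₂₃] <;> ring

theorem proj_add_e₃₁ (a b c : ℤ) : proj (a + 1) (b + 1) (c + 1) + (1 : ℤ) • e₃₁ =
    proj (a + 1) (b + 1) c := by
  rw [one_smul]
  ext <;> simp [proj, e₃₁] <;> ring

theorem proj_sub_e₁₂ (a b c : ℤ) : proj (a + 1) (b + 1) (c + 1) - (1 : ℤ) • e₁₂ =
    proj (a + 1) b c := by
  rw [one_smul]
  ext <;> simp [proj, e₁₂] <;> ring

theorem proj_sub_e₂₃ (a b c : ℤ) : proj (a + 1) (b + 1) (c + 1) - (1 : ℤ) • e₂₃ =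
    proj a (b + 1) c := by
  rw [one_smul]
  ext <;> simp [proj, e₂₃] <;> ring

theorem proj_sub_e₃₁ (a b c : ℤ) : proj (a + 1) (b + 1) (c + 1) - (1 : ℤ) • e₃₁ =
    proj a b (c + 1) := by
  rw [one_smul]
  ext <;> simp [proj, e₃₁] <;> ring

theorem proj_add_one (a b c : ℤ) : proj (a + 1) (b + 1) (c + 1) = proj a b c := by
  ext <;> simp [proj]

theorem evolve_of_closed {K : Type*} [Field K] {P : K → Prop} (hadd : ∀ {a b}, P a → P b → P (a + b))
    (hmul : ∀ {a b}, P a → P b → P (a * b)) (hdiv : ∀ {a b}, P a → P b → P (a / b)) {x : P₀ → K}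
    (hx : ∀ v, P (x v)) (σ : ℤ) : ∀ (n : ℕ) (v : P₀), P (evolve x σ n v)
  | 0, v => hx v
  | 1, v => hx v
  | 2, v => hx v
  | t + 3, v => by
      have h2 := evolve_of_closed hadd hmul hdiv hx σ (t + 2)
      have h1 := evolve_of_closed hadd hmul hdiv hx σ (t + 1)
      have h0 := evolve_of_closed hadd hmul hdiv hx σ t
      rw [evolve]
      exact hdiv (hadd (hadd (hmul (h2 _) (h1 _)) (hmul (h2 _) (h1 _))) (hmul (h2 _) (h1 _))) (h0 _)

/-- The solution on `ℤ³` with initial values `x`. -/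
noncomputable def solution {K : Type} [Field K] (x : P₀ → K) (a b c : ℤ) : K :=
  evolve x 1 (a + b + c).toNat (proj a b c)

theorem solution_init {K : Type} [Field K] (x : P₀ → K) (a b c : ℤ) (h2 : a + b + c ≤ 2) :
    solution x a b c = x (proj a b c) := by
  have : (a + b + c).toNat ≤ 2 := by omega
  unfold solution
  generalize (a + b + c).toNat = n at *
  interval_cases n <;> simp [evolve]

theorem isSol_solution {K : Type} [Field K] {x : P₀ → K} (hx : ∀ n v, evolve x 1 n v ≠ 0) :
    IsSol (solution x) where
  ne_zero a b c _ := hx _ _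
  step a b c h := by
    obtain ⟨t, ht⟩ := Int.eq_ofNat_of_zero_le h
    unfold solution
    rw [← proj_add_one a b c, show (a + 1 + (b + 1) + (c + 1)).toNat = t + 3 by omega, evolve,
      show (a + b + c).toNat = t by omega, div_mul_cancel₀ _ (hx _ _), proj_add_e₁₂, proj_add_e₂₃,
      proj_add_e₃₁, proj_sub_e₁₂, proj_sub_e₂₃, proj_sub_e₃₁,
      show (a + (b + 1) + (c + 1)).toNat = t + 2 by omega,
      show (a + 1 + b + (c + 1)).toNat = t + 2 by omega,
      show (a + 1 + (b + 1) + c).toNat = t + 2 by omega,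
      show (a + 1 + b + c).toNat = t + 1 by omega,
      show (a + (b + 1) + c).toNat = t + 1 by omega,
      show (a + b + (c + 1)).toNat = t + 1 by omega]

/-- The solution with independent initial values. -/
noncomputable def genericSol : ℤ → ℤ → ℤ → RatFun (ℤ × ℤ × ℤ) :=
  solution fun v => var (lift v)

theorem posAtOne_var {T : Type} (u : T) : PosAtOne (var u) :=
  ⟨X u, 1, by simp, by simp, by simp [var]⟩

theorem var_ne_zero {T : Type} (u : T) : var u ≠ 0 := (posAtOne_var u).ne_zero

theorem isSol_genericSol : IsSol genericSol :=
  isSol_solution fun n v => (evolve_of_closed (P := PosAtOne) PosAtOne.add PosAtOne.mul PosAtOne.div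
    (fun _ => posAtOne_var _) 1 n v).ne_zero

theorem isInit_genericSol : IsInit genericSol var where
  eq a b c h0 h2 := by rw [genericSol, solution_init _ _ _ _ h2, lift_proj a b c h0 h2]
  ne_zero := var_ne_zero

theorem evalAt_var {T : Type} (p : MvPolynomial T ℤ) :
    evalAt (var : T → RatFun T) p = algebraMap _ (RatFun T) p := by
  have : evalAt (var : T → RatFun T) = algebraMap _ (RatFun T) :=
    MvPolynomial.ringHom_ext (fun n => by simp [evalAt]) fun u => by simp [var]
  rw [this]

/-- Every value of a solution is one and the same rational function of the initial values. -/
theorem exists_ratio (n : ℕ) : ∀ a b c : ℤ, a + b + c = n →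
    ∃ U V : MvPolynomial (ℤ × ℤ × ℤ) ℤ, ∀ (K : Type) [Field K] (F : ℤ → ℤ → ℤ → K)
      (x : ℤ × ℤ × ℤ → K), IsSol F → IsInit F x → evalAt x V ≠ 0 ∧
        F a b c * evalAt x V = evalAt x U := by
  induction n using Nat.strong_induction_on with
  | _ n ih =>
    intro a b c h
    rcases le_or_gt n 2 with h2 | h2
    · exact ⟨X (a, b, c), 1, fun K _ F x hF hx => by
        simp [hx.eq a b c (by omega) (by omega)]⟩
    · have L : ∀ a' b' c' : ℤ, 0 ≤ a' + b' + c' → a' + b' + c' < n →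
        ∃ U V : MvPolynomial (ℤ × ℤ × ℤ) ℤ, ∀ (K : Type) [Field K] (F : ℤ → ℤ → ℤ → K)
          (x : ℤ × ℤ × ℤ → K), IsSol F → IsInit F x → evalAt x V ≠ 0 ∧
            F a' b' c' * evalAt x V = evalAt x U := fun a' b' c' h0 h1 =>
          ih (a' + b' + c').toNat (by omega) a' b' c' (by omega)
      obtain ⟨a, rfl⟩ : ∃ a', a = a' + 1 := ⟨a - 1, by ring⟩
      obtain ⟨b, rfl⟩ : ∃ b', b = b' + 1 := ⟨b - 1, by ring⟩
      obtain ⟨c, rfl⟩ : ∃ c', c = c' + 1 := ⟨c - 1, by ring⟩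
      obtain ⟨U₀, V₀, h₀⟩ := L a b c (by omega) (by omega)
      obtain ⟨U₁, V₁, h₁⟩ := L a (b + 1) (c + 1) (by omega) (by omega)
      obtain ⟨U₂, V₂, h₂⟩ := L (a + 1) b c (by omega) (by omega)
      obtain ⟨U₃, V₃, h₃⟩ := L (a + 1) b (c + 1) (by omega) (by omega)
      obtain ⟨U₄, V₄, h₄⟩ := L a (b + 1) c (by omega) (by omega)
      obtain ⟨U₅, V₅, h₅⟩ := L (a + 1) (b + 1) c (by omega) (by omega)
      obtain ⟨U₆, V₆, h₆⟩ := L a b (c + 1) (by omega) (by omega)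
      refine ⟨(U₁ * U₂ * (V₃ * V₄ * V₅ * V₆) + U₃ * U₄ * (V₁ * V₂ * V₅ * V₆) +
        U₅ * U₆ * (V₁ * V₂ * V₃ * V₄)) * V₀, U₀ * (V₁ * V₂ * V₃ * V₄ * V₅ * V₆),
        fun K _ F x hF hx => ?_⟩
      obtain ⟨n₀, e₀⟩ := h₀ K F x hF hx
      obtain ⟨n₁, e₁⟩ := h₁ K F x hF hx
      obtain ⟨n₂, e₂⟩ := h₂ K F x hF hx
      obtain ⟨n₃, e₃⟩ := h₃ K F x hF hx
      obtain ⟨n₄, e₄⟩ := h₄ K F x hF hx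
      obtain ⟨n₅, e₅⟩ := h₅ K F x hF hx
      obtain ⟨n₆, e₆⟩ := h₆ K F x hF hx
      have hs := hF.step a b c (by omega)
      have h0 := hF.ne_zero a b c (by omega)
      simp only [map_mul, map_add, ← e₀, ← e₁, ← e₂, ← e₃, ← e₄, ← e₅, ← e₆]
      refine ⟨by positivity, ?_⟩
      linear_combination (evalAt x V₀ * (evalAt x V₁ * evalAt x V₂ * evalAt x V₃ * evalAt x V₄ *
        evalAt x V₅ * evalAt x V₆)) * hs

/-- The value at `(a, b, c)` of a solution is a Laurent polynomial in the initial values. -/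
def IsLaurentAt (a b c : ℤ) : Prop :=
  ∃ (p : MvPolynomial (ℤ × ℤ × ℤ) ℤ) (m : ℤ × ℤ × ℤ →₀ ℕ), ∀ (K : Type) [Field K]
    (F : ℤ → ℤ → ℤ → K) (x : ℤ × ℤ × ℤ → K), IsSol F → IsInit F x →
    F a b c * evalAt x (monomial m (1 : ℤ)) = evalAt x p

/-- With the universal ratio `U / V` of `exists_ratio`, the hypothesis is a polynomial identity. It
can be evaluated at any solution, where `V` does not vanish. -/
theorem isLaurentAt_of_generic {a b c : ℤ} (h0 : 0 ≤ a + b + c)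
    (p : MvPolynomial (ℤ × ℤ × ℤ) ℤ) (m : ℤ × ℤ × ℤ →₀ ℕ)
    (h : genericSol a b c * algebraMap _ (RatFun (ℤ × ℤ × ℤ)) (monomial m (1 : ℤ)) =
      algebraMap _ (RatFun (ℤ × ℤ × ℤ)) p) : IsLaurentAt a b c := by
  refine ⟨p, m, fun K _ F x hF hx => ?_⟩
  obtain ⟨U, V, hUV⟩ := exists_ratio (a + b + c).toNat a b c (by omega)
  obtain ⟨hV, hU⟩ := hUV K F x hF hx
  have hg := (hUV _ _ _ isSol_genericSol isInit_genericSol).2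
  rw [evalAt_var, evalAt_var] at hg
  have key : U * monomial m 1 = p * V := by
    apply IsFractionRing.injective (MvPolynomial (ℤ × ℤ × ℤ) ℤ) (RatFun (ℤ × ℤ × ℤ))
    rw [map_mul, map_mul, ← hg, ← h]
    ring
  have key' := congrArg (evalAt x) key
  rw [map_mul, map_mul, ← hU] at key'
  apply mul_right_cancel₀ hV
  rw [← key']
  ring

theorem exists_clear_denominators {σ K : Type} [Field K] {x y : σ → K} (g : σ → MvPolynomial σ ℤ)
    (μ : σ → σ →₀ ℕ) (hy : ∀ w, y w * evalAt x (monomial (μ w) (1 : ℤ)) = evalAt x (g w))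
    (p : MvPolynomial σ ℤ) : ∃ (M : σ →₀ ℕ) (P : MvPolynomial σ ℤ),
      evalAt y p * evalAt x (monomial M (1 : ℤ)) = evalAt x P := by
  induction p using MvPolynomial.induction_on with
  | C n => exact ⟨0, C n, by simp [evalAt]⟩
  | add p q hp hq =>
    obtain ⟨M, P, h⟩ := hp
    obtain ⟨N, Q, h'⟩ := hq
    refine ⟨M + N, P * monomial N 1 + Q * monomial M 1, ?_⟩
    rw [monomial_add_one, map_add, map_add, map_mul, map_mul, map_mul, ← h, ← h']
    ring
  | mul_X p w hp =>
    obtain ⟨M, P, h⟩ := hp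
    refine ⟨M + μ w, P * g w, ?_⟩
    rw [monomial_add_one, map_mul, map_mul, map_mul, ← h, ← hy, evalAt_X]
    ring

/-- Here the numerator is needed explicitly: it is what appears in the denominator after
substituting into a Laurent polynomial. -/
theorem exists_clear_denominators_monomial {σ K : Type} [Field K] {x y : σ → K}
    (g : σ → MvPolynomial σ ℤ) (μ : σ → σ →₀ ℕ)
    (hy : ∀ w, y w * evalAt x (monomial (μ w) (1 : ℤ)) = evalAt x (g w)) (m : σ →₀ ℕ) :
    ∃ M : σ →₀ ℕ, evalAt y (monomial m (1 : ℤ)) * evalAt x (monomial M (1 : ℤ)) =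
      evalAt x (m.prod fun w k => g w ^ k) := by
  induction m using Finsupp.induction_linear with
  | zero => exact ⟨0, by simp⟩
  | add m n hm hn =>
    obtain ⟨M, h⟩ := hm
    obtain ⟨N, h'⟩ := hn
    refine ⟨M + N, ?_⟩
    rw [Finsupp.prod_add_index' (by simp) (by intros; ring), monomial_add_one, monomial_add_one,
      map_mul, map_mul, map_mul, ← h, ← h']
    ring
  | single w k =>
    refine ⟨k • μ w, ?_⟩
    have : monomial (k • μ w) (1 : ℤ) = monomial (μ w) 1 ^ k := by simp [monomial_pow]
    rw [Finsupp.prod_single_index (by simp), map_pow, ← hy, this, map_pow, mul_pow]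
    simp

theorem IsSol.shift {K : Type} [Field K] {F : ℤ → ℤ → ℤ → K} (hF : IsSol F) {s : ℤ} (hs : 0 ≤ s) :
    IsSol fun a b c => F (a + s) b c where
  ne_zero a b c h := hF.ne_zero _ _ _ (by omega)
  step a b c h := by
    have := hF.step (a + s) b c (by omega)
    rwa [show a + s + 1 = a + 1 + s by ring] at this

/-- The values of `F` on three consecutive levels, as initial values. -/
def initOf {K : Type} [Field K] (F : ℤ → ℤ → ℤ → K) (w : ℤ × ℤ × ℤ) : K :=
  if 0 ≤ w.1 + w.2.1 + w.2.2 ∧ w.1 + w.2.1 + w.2.2 ≤ 2 then F w.1 w.2.1 w.2.2 else 1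

theorem IsSol.isInit_initOf {K : Type} [Field K] {F : ℤ → ℤ → ℤ → K} (hF : IsSol F) :
    IsInit F (initOf F) where
  eq a b c h0 h2 := if_pos ⟨h0, h2⟩
  ne_zero w := by
    unfold initOf
    split_ifs with h
    · exact hF.ne_zero _ _ _ h.1
    · exact one_ne_zero

/-- If the value at `(a, b, c)` is a Laurent polynomial in the initial values of the solution
shifted by `s`, and the latter have numerators `g w`, then it has the denominator `∏ g w ^ k w`. -/
theorem exists_denominator {a b c s : ℤ} (hs : 0 ≤ s) (h : IsLaurentAt (a - s) b c)
    (g : ℤ × ℤ × ℤ → MvPolynomial (ℤ × ℤ × ℤ) ℤ) (μ : ℤ × ℤ × ℤ → ℤ × ℤ × ℤ →₀ ℕ)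
    (hg : ∀ w, initOf (fun a b c => genericSol (a + s) b c) w *
      evalAt var (monomial (μ w) (1 : ℤ)) = evalAt var (g w)) :
    ∃ (P : MvPolynomial (ℤ × ℤ × ℤ) ℤ) (M k : ℤ × ℤ × ℤ →₀ ℕ), genericSol a b c *
      algebraMap _ (RatFun (ℤ × ℤ × ℤ)) (monomial M 1 * k.prod fun w k => g w ^ k) =
      algebraMap _ (RatFun (ℤ × ℤ × ℤ)) P := by
  obtain ⟨p, m, hp⟩ := h
  have hF := isSol_genericSol.shift hs
  have e := hp _ _ _ hF hF.isInit_initOf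
  rw [sub_add_cancel] at e
  obtain ⟨M, P, hM⟩ := exists_clear_denominators g μ hg p
  obtain ⟨N, hN⟩ := exists_clear_denominators_monomial g μ hg m
  refine ⟨P * monomial N 1, M, m, ?_⟩
  rw [← evalAt_var, ← evalAt_var, map_mul, map_mul, ← hN, ← hM, ← e]
  ring

end CubeRecurrence

/-! ### The Laurent phenomenon -/

namespace CubeRecurrence

open MvPolynomial

/-- Monomials are split off because they are allowed in the final denominator. Only the cofactor has
to be prime to `G`. -/
theorem exists_monomial_mul_isRelPrime {σ : Type} {G : MvPolynomial σ ℤ} (g : σ → MvPolynomial σ ℤ)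
    (hg : ∀ w, ∃ (m : σ →₀ ℕ) (A : MvPolynomial σ ℤ), g w = monomial m 1 * A ∧
      IsRelPrime A G ∧ A ≠ 0)
    (k : σ →₀ ℕ) : ∃ (m : σ →₀ ℕ) (A : MvPolynomial σ ℤ),
      (k.prod fun w k => g w ^ k) = monomial m 1 * A ∧ IsRelPrime A G ∧ A ≠ 0 := by
  induction k using Finsupp.induction_linear with
  | zero => exact ⟨0, 1, by simp, isRelPrime_one_left, one_ne_zero⟩
  | add m n hm hn =>
    obtain ⟨M, P, h, hP, hP0⟩ := hm
    obtain ⟨N, Q, h', hQ, hQ0⟩ := hn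
    refine ⟨M + N, P * Q, ?_, hP.mul_left hQ, mul_ne_zero hP0 hQ0⟩
    rw [Finsupp.prod_add_index' (by simp) (by intros; ring), h, h', monomial_add_one]
    ring
  | single w k =>
    obtain ⟨m, A, h, hA, hA0⟩ := hg w
    refine ⟨k • m, A ^ k, ?_, hA.pow_left, pow_ne_zero k hA0⟩
    have : monomial (k • m) (1 : ℤ) = monomial m 1 ^ k := by simp [monomial_pow]
    rw [Finsupp.prod_single_index (by simp), h, this, mul_pow]

/-- In terms of the levels `1, 2, 3`, only numerators of cubes on level `0` can be denominators. -/
theorem exists_denominator_one {a b c : ℤ} (h : IsLaurentAt (a - 1) b c)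
    {G : MvPolynomial (ℤ × ℤ × ℤ) ℤ} (hG : ∀ a b c : ℤ, a + b + c = 0 → ¬ cubeNum a b c ∣ G) :
    ∃ (P A : MvPolynomial (ℤ × ℤ × ℤ) ℤ) (M : ℤ × ℤ × ℤ →₀ ℕ), IsRelPrime A G ∧ A ≠ 0 ∧
      genericSol a b c * algebraMap _ (RatFun (ℤ × ℤ × ℤ)) (monomial M 1 * A) =
        algebraMap _ (RatFun (ℤ × ℤ × ℤ)) P := by
  have hS := isSol_genericSol
  have hI := isInit_genericSol
  have : ∀ w : ℤ × ℤ × ℤ, ∃ (g : MvPolynomial (ℤ × ℤ × ℤ) ℤ) (μ : ℤ × ℤ × ℤ →₀ ℕ),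
      initOf (fun a b c => genericSol (a + 1) b c) w * evalAt var (monomial μ (1 : ℤ)) =
        evalAt var g ∧ ∃ (m : ℤ × ℤ × ℤ →₀ ℕ) (A : MvPolynomial (ℤ × ℤ × ℤ) ℤ),
          g = monomial m 1 * A ∧ IsRelPrime A G ∧ A ≠ 0 := by
    rintro ⟨a, b, c⟩
    -- Because of the shift by `1`, this is level `3` of `genericSol`: the value is `cubeNum`
    -- divided by the variable at the bottom of the cube.
    by_cases h2 : a + b + c = 2
    · refine ⟨cubeNum a (b - 1) (c - 1), Finsupp.single (a, b - 1, c - 1) 1, ?_, 0, _,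
        by simp; rfl, ((irreducible_cubeNum _ _ _).isRelPrime_iff_not_dvd).mpr
          (hG _ _ _ (by omega)), (irreducible_cubeNum _ _ _).ne_zero⟩
      have := hS.step a (b - 1) (c - 1) (by omega)
      simp only [sub_add_cancel] at this
      unfold initOf
      rw [if_pos (by simp only; omega), cubeNum]
      simp only [map_add, map_mul, evalAt_X, evalAt_monomial, sub_add_cancel, Int.cast_one, one_mul]
      rw [Finsupp.prod_single_index (by simp), pow_one, hI.eq _ _ _ (by omega) (by omega), this,
        hI.eq _ _ _ (by omega) (by omega), hI.eq _ _ _ (by omega) (by omega),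
        hI.eq _ _ _ (by omega) (by omega), hI.eq _ _ _ (by omega) (by omega),
        hI.eq _ _ _ (by omega) (by omega), hI.eq _ _ _ (by omega) (by omega)]
    · by_cases h0 : 0 ≤ a + b + c ∧ a + b + c ≤ 1
      · refine ⟨X (a + 1, b, c), 0, ?_, Finsupp.single (a + 1, b, c) 1, 1, by rw [mul_one]; rfl,
          isRelPrime_one_left, one_ne_zero⟩
        unfold initOf
        rw [if_pos (by simp only; omega)]
        simp [hI.eq _ _ _ (show 0 ≤ a + 1 + b + c by omega) (by omega)]
      · refine ⟨1, 0, ?_, 0, 1, by simp, isRelPrime_one_left, one_ne_zero⟩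
        unfold initOf
        rw [if_neg (by simp only; omega)]
        simp
  choose g μ hg hgA using this
  obtain ⟨P, M, k, hP⟩ := exists_denominator (by norm_num) h g μ hg
  obtain ⟨m, A, hk, hA, hA0⟩ := exists_monomial_mul_isRelPrime g hgA k
  refine ⟨P, A, M + m, hA, hA0, ?_⟩
  rw [← hP, hk, monomial_add_one, mul_assoc]

/-- In terms of the levels `4, 5, 6`, no numerator of a cube on level `0` is needed as a
denominator. -/
theorem exists_denominator_four {a b c : ℤ} (h : IsLaurentAt (a - 4) b c) :
    ∃ P G : MvPolynomial (ℤ × ℤ × ℤ) ℤ, (∀ a b c : ℤ, a + b + c = 0 → ¬ cubeNum a b c ∣ G) ∧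
      genericSol a b c * algebraMap _ (RatFun (ℤ × ℤ × ℤ)) G =
        algebraMap _ (RatFun (ℤ × ℤ × ℤ)) P := by
  have : ∀ w : ℤ × ℤ × ℤ, ∃ (g : MvPolynomial (ℤ × ℤ × ℤ) ℤ) (μ : ℤ × ℤ × ℤ →₀ ℕ),
      initOf (fun a b c => genericSol (a + 4) b c) w * evalAt var (monomial μ (1 : ℤ)) =
        evalAt var g ∧ ∀ (F : ℤ → ℤ → ℤ → ZMod 5) (x : ℤ × ℤ × ℤ → ZMod 5), IsRegularSol F →
        IsInit F x → (∀ a b c, a + b + c ≠ 3 → F a b c ≠ 0) → evalAt x g ≠ 0 := by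
    rintro ⟨a, b, c⟩
    by_cases h0 : 0 ≤ a + b + c ∧ a + b + c ≤ 2
    -- The same `p` and `m` serve the generic solution and the solutions over `ZMod 5`, as `le_six`
    -- is uniform in the field and allows zeros on level `3`.
    · obtain ⟨p, m, hp⟩ := IsLaurent.le_six (a + 4) b c (by omega) (by omega)
      refine ⟨p, m, ?_, fun F x hF hx hne => ?_⟩
      · unfold initOf
        rw [if_pos (by simp only; omega)]
        exact hp _ _ _ isSol_genericSol.isRegularSol isInit_genericSol
      · rw [← hp _ _ _ hF hx]
        exact mul_ne_zero (hne _ _ _ (by omega)) (evalAt_monomial_ne_zero hx.ne_zero _)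
    · refine ⟨1, 0, ?_, fun _ _ _ _ _ => by simp⟩
      unfold initOf
      rw [if_neg (by simp only; omega)]
      simp
  choose g μ hg hgA using this
  obtain ⟨P, M, k, hP⟩ := exists_denominator (by norm_num) h g μ hg
  refine ⟨P, _, fun a b c h0 hd => ?_, hP⟩
  obtain ⟨F, x, hF, hx, hne, hz⟩ := exists_isRegularSol_vanishing a b c h0
  obtain ⟨q, hq⟩ := hd
  have := congrArg (evalAt x) hq
  rw [map_mul, map_mul, hz, zero_mul] at this
  refine mul_ne_zero (evalAt_monomial_ne_zero hx.ne_zero _) ?_ this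
  rw [Finsupp.prod, map_prod]
  refine Finset.prod_ne_zero_iff.mpr fun w _ => ?_
  rw [map_pow]
  exact pow_ne_zero _ (hgA w F x hF hx hne)

/-- The Laurent phenomenon for the cube recurrence. -/
theorem isLaurentAt (n : ℕ) : ∀ a b c : ℤ, a + b + c = n → IsLaurentAt a b c := by
  induction n using Nat.strong_induction_on with
  | _ n ih =>
    intro a b c h
    rcases le_or_gt n 6 with h6 | h6
    · obtain ⟨p, m, hp⟩ := IsLaurent.le_six a b c (by omega) (by omega)
      exact ⟨p, m, fun K _ F x hF hx => hp K F x hF.isRegularSol hx⟩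
    · obtain ⟨P₂, G, hG, h₂⟩ :=
        exists_denominator_four (ih (n - 4) (by omega) (a - 4) b c (by omega))
      obtain ⟨P₁, A, M, hA, hA0, h₁⟩ :=
        exists_denominator_one (ih (n - 1) (by omega) (a - 1) b c (by omega)) hG
      -- Two fractions for one value, with denominators `A` times a monomial and `G`. As `A` is
      -- prime to `G`, it divides `P₁` and cancels.
      have key : P₁ * G = A * (P₂ * monomial M 1) := by
        apply IsFractionRing.injective (MvPolynomial (ℤ × ℤ × ℤ) ℤ) (RatFun (ℤ × ℤ × ℤ))
        rw [map_mul, map_mul, map_mul, ← h₁, ← h₂, map_mul]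
        ring
      obtain ⟨Q, rfl⟩ := hA.dvd_of_dvd_mul_right ⟨_, key⟩
      refine isLaurentAt_of_generic (by omega) Q M ?_
      have hA0 : algebraMap _ (RatFun (ℤ × ℤ × ℤ)) A ≠ 0 :=
        (map_ne_zero_iff _ (IsFractionRing.injective _ _)).mpr hA0
      apply mul_right_cancel₀ hA0
      rw [map_mul, map_mul] at h₁
      rw [mul_assoc, h₁, mul_comm]

end CubeRecurrence

/-! ### Exponents of a Laurent polynomial from its growth along monomial curves -/

namespace CubeRecurrence

theorem zpow_finsetSum {K ι : Type*} [Field K] {s : K} (hs : s ≠ 0) (S : Finset ι) (f : ι → ℤ) :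
    s ^ ∑ i ∈ S, f i = ∏ i ∈ S, s ^ f i := by
  classical
  induction S using Finset.induction_on with
  | empty => simp
  | insert i S hi ih => rw [Finset.sum_insert hi, Finset.prod_insert hi, zpow_add₀ hs, ih]

/-- The value of the Laurent monomial with exponents `m`. -/
def monomialAt {T K : Type} [Field K] (x : T → K) (m : T →₀ ℤ) : K := m.prod fun u k => x u ^ k

/-- The value of a Laurent polynomial. -/
def LaurentPoly.evalAt {T K : Type} [Field K] (x : T → K) (p : LaurentPoly T) : K :=
  p.coeff.sum fun m c => (c : K) * monomialAt x m

theorem LaurentPoly.evalAt_var {T : Type} (p : LaurentPoly T) : p.evalAt var = p.toRatFun := rfl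

theorem monomialAt_add {T K : Type} [Field K] {x : T → K} (hx : ∀ u, x u ≠ 0) (m n : T →₀ ℤ) :
    monomialAt x (m + n) = monomialAt x m * monomialAt x n :=
  Finsupp.prod_add_index' (by simp) fun u k l => zpow_add₀ (hx u) k l

theorem monomialAt_mapDomain {T T' K : Type} [Field K] {x : T' → K} (hx : ∀ u, x u ≠ 0)
    (κ : T → T') (m : T →₀ ℤ) : monomialAt x (m.mapDomain κ) = monomialAt (fun u => x (κ u)) m :=
  Finsupp.prod_mapDomain_index (by simp) fun u k l => zpow_add₀ (hx u) k l

/-- An exponent vector with natural entries as one with integer entries. -/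
noncomputable def toIntExp {T : Type} (m : T →₀ ℕ) : T →₀ ℤ :=
  m.mapRange (fun k : ℕ => (k : ℤ)) (by simp)

theorem monomialAt_toIntExp {T K : Type} [Field K] (x : T → K) (m : T →₀ ℕ) :
    monomialAt x (toIntExp m) = CubeRecurrence.evalAt x (MvPolynomial.monomial m (1 : ℤ)) := by
  rw [monomialAt, toIntExp, Finsupp.prod_mapRange_index (by simp), evalAt_monomial]
  simp

/-- The Laurent polynomial `p / x ^ m`, with the variables renamed along `κ`. -/
noncomputable def quotientPoly {T T' : Type} (κ : T → T') (p : MvPolynomial T ℤ) (m : T →₀ ℕ) :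
    LaurentPoly T' :=
  AddMonoidAlgebra.mapDomain (fun n => (toIntExp n - toIntExp m).mapDomain κ) p

theorem evalAt_quotientPoly {T T' K : Type} [Field K] {x : T' → K} (hx : ∀ u, x u ≠ 0)
    (κ : T → T') (p : MvPolynomial T ℤ) (m : T →₀ ℕ) :
    (quotientPoly κ p m).evalAt x * evalAt (fun u => x (κ u)) (MvPolynomial.monomial m (1 : ℤ)) =
      evalAt (fun u => x (κ u)) p := by
  have h1 : (quotientPoly κ p m).evalAt x = p.support.sum fun n =>
      ((p.coeff n : ℤ) : K) * monomialAt x ((toIntExp n - toIntExp m).mapDomain κ) := by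
    rw [LaurentPoly.evalAt, quotientPoly, AddMonoidAlgebra.coeff_mapDomain,
      Finsupp.sum_mapDomain_index (by simp) (by intros; push_cast; ring)]
    rfl
  have h2 : evalAt (fun u => x (κ u)) p = p.support.sum fun n =>
      ((p.coeff n : ℤ) : K) * monomialAt (fun u => x (κ u)) (toIntExp n) := by
    simp only [monomialAt_toIntExp, evalAt_monomial, Int.cast_one, one_mul]
    exact MvPolynomial.eval₂_eq (Int.castRingHom K) _ _
  rw [h1, h2, Finset.sum_mul]
  refine Finset.sum_congr rfl fun n _ => ?_
  rw [mul_assoc, monomialAt_mapDomain hx, ← monomialAt_toIntExp,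
    ← monomialAt_add fun u => hx (κ u), sub_add_cancel]

/-- Renaming variables can cancel terms but creates no new exponents, so bounds for independent
variables carry over to the torus. -/
theorem exists_of_mem_support_quotientPoly {T T' : Type} {κ : T → T'} {p : MvPolynomial T ℤ}
    {m : T →₀ ℕ} {e : T' →₀ ℤ} (he : e ∈ (quotientPoly κ p m).coeff.support) :
    ∃ e' ∈ (quotientPoly id p m).coeff.support, e = e'.mapDomain κ := by
  classical
  have h := Finsupp.mapDomain_support he
  obtain ⟨n, hn, rfl⟩ := Finset.mem_image.mp h
  refine ⟨toIntExp n - toIntExp m, ?_, rfl⟩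
  have hinj : Function.Injective fun n : T →₀ ℕ =>
      (toIntExp n - toIntExp m).mapDomain (id : T → T) := by
    intro n n' h
    simp only [Finsupp.mapDomain_id, sub_left_inj] at h
    exact Finsupp.mapRange_injective _ _ Nat.cast_injective h
  rw [quotientPoly, AddMonoidAlgebra.coeff_mapDomain,
    Finsupp.mapDomain_support_of_injective hinj]
  exact Finset.mem_image.mpr ⟨n, hn, by simp⟩

/-- The weight of the exponent vector `m`. -/
def weight {T : Type} (ω : T → ℤ) (m : T →₀ ℤ) : ℤ := m.sum fun u k => k * ω u

theorem monomialAt_mul_zpow {T : Type} (c : T → ℝ) (ω : T → ℤ) {s : ℝ} (hs : s ≠ 0) (m : T →₀ ℤ) :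
    monomialAt (fun u => c u * s ^ ω u) m = monomialAt c m * s ^ weight ω m := by
  simp only [monomialAt, weight, Finsupp.prod, Finsupp.sum, mul_zpow, Finset.prod_mul_distrib]
  congr 1
  rw [zpow_finsetSum hs]
  refine Finset.prod_congr rfl fun u _ => ?_
  rw [← zpow_mul, mul_comm]

/-- The Laurent monomials as characters on points with coordinates `2 ^ n`. -/
noncomputable def monomialHom {T : Type} (m : T →₀ ℤ) : Multiplicative (T → ℕ) →* ℝ where
  toFun n := monomialAt (fun u => (2 : ℝ) ^ n.toAdd u) m
  map_one' := by simp [monomialAt]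
  map_mul' n n' := by
    simp [monomialAt, pow_add, mul_zpow, Finsupp.prod, Finset.prod_mul_distrib]

theorem monomialHom_injective {T : Type} :
    Function.Injective (monomialHom : (T →₀ ℤ) → Multiplicative (T → ℕ) →* ℝ) := by
  classical
  intro m m' h
  ext v
  -- The point with coordinate `2` at `v` and `1` elsewhere recovers the exponent of the variable
  -- `v`.
  have h1 : ∀ m : T →₀ ℤ, monomialHom m (Multiplicative.ofAdd (Pi.single v 1)) = (2 : ℝ) ^ m v := by
    intro m
    simp only [monomialHom, monomialAt, MonoidHom.coe_mk, OneHom.coe_mk, toAdd_ofAdd]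
    rw [Finsupp.prod, Finset.prod_eq_single v]
    · simp
    · intro u _ hu
      simp [Pi.single_eq_of_ne hu]
    · intro hv
      simp [Finsupp.notMem_support_iff.mp hv]
  have h2 := h1 m
  rw [h, h1 m'] at h2
  exact (zpow_right_injective₀ (by norm_num : (0 : ℝ) < 2) (by norm_num) h2).symm

/-- Distinct Laurent monomials are distinct characters, hence linearly independent by Dedekind; the
points `2 ^ n` already detect this and are positive. -/
theorem exists_sum_monomialAt_ne_zero {T : Type} (S : Finset (T →₀ ℤ)) (a : (T →₀ ℤ) → ℝ)
    {m : T →₀ ℤ} (hm : m ∈ S) (ha : a m ≠ 0) :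
    ∃ c : T → ℝ, (∀ u, 0 < c u) ∧ ∑ m ∈ S, a m * monomialAt c m ≠ 0 := by
  by_contra! H
  have hli := (linearIndependent_monoidHom (Multiplicative (T → ℕ)) ℝ).comp _
    (monomialHom_injective (T := T))
  refine ha (linearIndependent_iff'.mp hli S a ?_ m hm)
  ext n
  have := H (fun u => (2 : ℝ) ^ n.toAdd u) fun u => by positivity
  simpa [monomialHom] using this

open Filter Topology in
/-- An upper bound for the growth of the values along all the curves `c u * s ^ ω u` bounds the
weights of all exponents. -/
theorem weight_le_of_evalAt_le {T : Type} (p : LaurentPoly T) (ω : T → ℤ) (D : ℤ)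
    (h : ∀ c : T → ℝ, (∀ u, 0 < c u) →
      ∃ C : ℝ, ∀ s : ℝ, 1 ≤ s → |p.evalAt fun u => c u * s ^ ω u| ≤ C * s ^ D)
    {m : T →₀ ℤ} (hm : m ∈ p.coeff.support) : weight ω m ≤ D := by
  classical
  by_contra! hlt
  obtain ⟨m₀, hm₀, hmax⟩ := p.coeff.support.exists_max_image (weight ω) ⟨m, hm⟩
  have hD : D < weight ω m₀ := hlt.trans_le (hmax m hm)
  -- The part of maximal weight is the leading coefficient in `s`. Its integer coefficients may have
  -- both signs, so `c` is chosen to avoid cancellation.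
  obtain ⟨c, hc, hne⟩ := exists_sum_monomialAt_ne_zero
    (p.coeff.support.filter fun m => weight ω m = weight ω m₀) (fun m => (p.coeff m : ℝ))
    (Finset.mem_filter.mpr ⟨hm₀, rfl⟩) (by exact_mod_cast Finsupp.mem_support_iff.mp hm₀)
  obtain ⟨C, hC⟩ := h c hc
  refine hne ?_
  have lim1 : Tendsto (fun s : ℝ => ∑ m ∈ p.coeff.support,
      (p.coeff m : ℝ) * monomialAt c m * s ^ (weight ω m - weight ω m₀)) atTop
      (𝓝 (∑ m ∈ p.coeff.support, if weight ω m = weight ω m₀ then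
        (p.coeff m : ℝ) * monomialAt c m else 0)) := by
    refine tendsto_finsetSum _ fun m hm => ?_
    split_ifs with hw
    · simp [hw]
    · have := hmax m hm
      have hz := (tendsto_zpow_atTop_zero (𝕜 := ℝ) (n := weight ω m - weight ω m₀)
        (by omega)).const_mul ((p.coeff m : ℝ) * monomialAt c m)
      simpa using hz
  have lim2 : Tendsto (fun s : ℝ => ∑ m ∈ p.coeff.support,
      (p.coeff m : ℝ) * monomialAt c m * s ^ (weight ω m - weight ω m₀)) atTop (𝓝 0) := by
    have hz := (tendsto_zpow_atTop_zero (𝕜 := ℝ) (n := D - weight ω m₀) (by omega)).const_mul C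
    rw [mul_zero] at hz
    refine squeeze_zero_norm' ?_ hz
    filter_upwards [eventually_ge_atTop 1] with s hs
    have hs0 : 0 < s := by linarith
    have e : p.evalAt (fun u => c u * s ^ ω u) = ∑ m ∈ p.coeff.support,
        (p.coeff m : ℝ) * (monomialAt c m * s ^ weight ω m) := by
      simp only [LaurentPoly.evalAt, Finsupp.sum, monomialAt_mul_zpow c ω hs0.ne']
    have e2 : ∑ m ∈ p.coeff.support, (p.coeff m : ℝ) * monomialAt c m *
        s ^ (weight ω m - weight ω m₀) = p.evalAt (fun u => c u * s ^ ω u) / s ^ weight ω m₀ := by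
      rw [e, Finset.sum_div]
      refine Finset.sum_congr rfl fun m _ => ?_
      rw [zpow_sub₀ hs0.ne']
      ring
    rw [e2, Real.norm_eq_abs, abs_div, abs_of_pos (zpow_pos hs0 (weight ω m₀)),
      zpow_sub₀ hs0.ne', ← mul_div_assoc]
    exact div_le_div_of_nonneg_right (hC s hs) (zpow_pos hs0 _).le
  rw [Finset.sum_filter]
  exact tendsto_nhds_unique lim1 lim2

theorem le_degreeIn {T : Type} {p : LaurentPoly T} (u : T) {m : T →₀ ℤ}
    (hm : m ∈ p.coeff.support) : m u ≤ degreeIn u p :=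
  le_csSup ((p.coeff.support.finite_toSet.image _).bddAbove) ⟨m, hm, rfl⟩

theorem abs_degreeIn_le {T : Type} {p : LaurentPoly T} (u : T) {B : ℤ} (hB : 0 ≤ B)
    (h : ∀ m ∈ p.coeff.support, |m u| ≤ B) : |degreeIn u p| ≤ B := by
  rcases (p.coeff.support : Set (T →₀ ℤ)).eq_empty_or_nonempty with h0 | h0
  · rw [degreeIn, h0]
    simpa using hB
  · obtain ⟨m, hm, e⟩ := (h0.image fun m : T →₀ ℤ => m u).csSup_mem
      (p.coeff.support.finite_toSet.image _)
    rw [degreeIn, ← e]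
    exact h m hm

theorem abs_lowDegreeIn_le {T : Type} {p : LaurentPoly T} (u : T) {B : ℤ} (hB : 0 ≤ B)
    (h : ∀ m ∈ p.coeff.support, |m u| ≤ B) : |lowDegreeIn u p| ≤ B := by
  rcases (p.coeff.support : Set (T →₀ ℤ)).eq_empty_or_nonempty with h0 | h0
  · rw [lowDegreeIn, h0]
    simpa using hB
  · obtain ⟨m, hm, e⟩ := (h0.image fun m : T →₀ ℤ => m u).csInf_mem
      (p.coeff.support.finite_toSet.image _)
    rw [lowDegreeIn, ← e]
    exact h m hm

theorem weight_single {T : Type} [DecidableEq T] (u : T) (k : ℤ) (m : T →₀ ℤ) :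
    weight (Pi.single u k) m = m u * k := by
  rw [weight, Finsupp.sum, Finset.sum_eq_single u]
  · simp
  · intro v _ hv
    simp [Pi.single_eq_of_ne hv]
  · intro hu
    simp [Finsupp.notMem_support_iff.mp hu]

/-- A lower bound for the growth of the values in the variable `x_u` bounds the degree below. -/
theorem le_degreeIn_of_le_evalAt {T : Type} [DecidableEq T] (p : LaurentPoly T) (u : T) (D : ℤ)
    {c : ℝ} (hc : 0 < c)
    (h : ∀ s : ℝ, 1 ≤ s → c * s ^ D ≤ p.evalAt fun v => s ^ (Pi.single u 1 : T → ℤ) v) :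
    D ≤ degreeIn u p := by
  by_contra! hlt
  set d := degreeIn u p
  -- With all other variables equal to `1`, the value is at most `A * s ^ d`. If `d < D`, then `c *
  -- s ≤ A` for all `s ≥ 1`, which is absurd.
  set A : ℝ := ∑ m ∈ p.coeff.support, |(p.coeff m : ℝ)|
  have hA : ∀ s : ℝ, 1 ≤ s → c * s ^ D ≤ A * s ^ d := by
    intro s hs
    have hs0 : 0 < s := by linarith
    refine (h s hs).trans ?_
    rw [LaurentPoly.evalAt, Finsupp.sum, Finset.sum_mul]
    refine Finset.sum_le_sum fun m hm => ?_
    have := monomialAt_mul_zpow (fun _ => 1) (Pi.single u 1 : T → ℤ) hs0.ne' m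
    simp only [one_mul] at this
    have h1 : monomialAt (fun _ : T => (1 : ℝ)) m = 1 := by simp [monomialAt]
    rw [this, h1, one_mul, weight_single, mul_one]
    exact mul_le_mul (le_abs_self _) (zpow_le_zpow_right₀ hs (le_degreeIn u hm))
      (zpow_pos hs0 _).le (abs_nonneg _)
  have hA' : ∀ s : ℝ, 1 ≤ s → c * s ≤ A := by
    intro s hs
    have hs0 : 0 < s := by linarith
    have h1 : s ^ d * s ≤ s ^ D := by
      rw [← zpow_add_one₀ hs0.ne']
      exact zpow_le_zpow_right₀ hs (by omega)
    have h2 : c * s * s ^ d ≤ A * s ^ d := by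
      refine le_trans ?_ (hA s hs)
      rw [mul_assoc, mul_comm s]
      exact mul_le_mul_of_nonneg_left h1 hc.le
    exact le_of_mul_le_mul_right h2 (zpow_pos hs0 _)
  have hA0 : 0 ≤ A := Finset.sum_nonneg fun _ _ => abs_nonneg _
  have := hA' (A / c + 1) (by have : 0 ≤ A / c := by positivity
                              linarith)
  rw [mul_add, mul_div_cancel₀ _ hc.ne'] at this
  linarith

end CubeRecurrence

/-! ### Tropical recurrence on `ℤ³` and the bound for single exponents -/

namespace CubeRecurrence

/-- For `s ≥ 1`, `f s` lies between two positive multiples of `s ^ d`. -/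
def IsTheta (f : ℝ → ℝ) (d : ℤ) : Prop :=
  ∃ c C : ℝ, 0 < c ∧ 0 < C ∧ ∀ s : ℝ, 1 ≤ s → c * s ^ d ≤ f s ∧ f s ≤ C * s ^ d

namespace IsTheta

variable {f g : ℝ → ℝ} {d e : ℤ}

theorem add (hf : IsTheta f d) (hg : IsTheta g e) : IsTheta (fun s => f s + g s) (max d e) := by
  obtain ⟨c, C, hc, hC, h⟩ := hf
  obtain ⟨c', C', hc', hC', h'⟩ := hg
  refine ⟨min c c', C + C', lt_min hc hc', add_pos hC hC', fun s hs => ?_⟩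
  obtain ⟨h1, h2⟩ := h s hs
  obtain ⟨h3, h4⟩ := h' s hs
  have hd : 0 < s ^ d := zpow_pos (by linarith) _
  have he : 0 < s ^ e := zpow_pos (by linarith) _
  have hd' : s ^ d ≤ s ^ max d e := zpow_le_zpow_right₀ hs (le_max_left _ _)
  have he' : s ^ e ≤ s ^ max d e := zpow_le_zpow_right₀ hs (le_max_right _ _)
  have u1 := mul_le_mul_of_nonneg_left hd' hC.le
  have u2 := mul_le_mul_of_nonneg_left he' hC'.le
  have v1 := mul_pos hc hd
  have v2 := mul_pos hc' he
  constructor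
  · rcases max_choice d e with h | h <;> rw [h]
    · have := mul_le_mul_of_nonneg_right (min_le_left c c') hd.le
      linarith
    · have := mul_le_mul_of_nonneg_right (min_le_right c c') he.le
      linarith
  · linarith

theorem mul (hf : IsTheta f d) (hg : IsTheta g e) : IsTheta (fun s => f s * g s) (d + e) := by
  obtain ⟨c, C, hc, hC, h⟩ := hf
  obtain ⟨c', C', hc', hC', h'⟩ := hg
  refine ⟨c * c', C * C', mul_pos hc hc', mul_pos hC hC', fun s hs => ?_⟩
  obtain ⟨h1, h2⟩ := h s hs
  obtain ⟨h3, h4⟩ := h' s hs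
  have hs0 : 0 < s := by linarith
  have hd : 0 < s ^ d := zpow_pos hs0 _
  have he : 0 < s ^ e := zpow_pos hs0 _
  rw [zpow_add₀ hs0.ne', mul_mul_mul_comm, mul_mul_mul_comm C]
  exact ⟨mul_le_mul h1 h3 (by positivity) ((by positivity : 0 ≤ c * s ^ d).trans h1),
    mul_le_mul h2 h4 ((by positivity : 0 ≤ c' * s ^ e).trans h3) (by positivity)⟩

theorem inv (hf : IsTheta f d) : IsTheta (fun s => (f s)⁻¹) (-d) := by
  obtain ⟨c, C, hc, hC, h⟩ := hf
  refine ⟨C⁻¹, c⁻¹, inv_pos.mpr hC, inv_pos.mpr hc, fun s hs => ?_⟩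
  obtain ⟨h1, h2⟩ := h s hs
  have hs0 : 0 < s := by linarith
  have hd : 0 < s ^ d := zpow_pos hs0 _
  have hcd : 0 < c * s ^ d := by positivity
  rw [zpow_neg, ← mul_inv, ← mul_inv]
  exact ⟨inv_anti₀ (hcd.trans_le h1) h2, inv_anti₀ hcd h1⟩

theorem congr (hf : IsTheta f d) (h : ∀ s, 1 ≤ s → f s = g s) : IsTheta g d := by
  obtain ⟨c, C, hc, hC, h'⟩ := hf
  exact ⟨c, C, hc, hC, fun s hs => h s hs ▸ h' s hs⟩

theorem const_mul_zpow {c : ℝ} (hc : 0 < c) (d : ℤ) : IsTheta (fun s => c * s ^ d) d :=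
  ⟨c, c, hc, hc, fun _ _ => ⟨le_rfl, le_rfl⟩⟩

end IsTheta

/-- The tropical cube recurrence on the part `0 ≤ a + b + c` of `ℤ³`. -/
def IsTrop (D : ℤ → ℤ → ℤ → ℤ) : Prop :=
  ∀ a b c, 0 ≤ a + b + c → D (a + 1) (b + 1) (c + 1) + D a b c =
    max (max (D a (b + 1) (c + 1) + D (a + 1) b c) (D (a + 1) b (c + 1) + D a (b + 1) c))
      (D (a + 1) (b + 1) c + D a b (c + 1))

/-- The orders of growth of solutions satisfy the tropical recurrence. -/
theorem isTheta_of_isTrop {F : ℝ → ℤ → ℤ → ℤ → ℝ} {D : ℤ → ℤ → ℤ → ℤ}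
    (hF : ∀ s, 1 ≤ s → IsSol (F s)) (hD : IsTrop D)
    (h0 : ∀ a b c, 0 ≤ a + b + c → a + b + c ≤ 2 → IsTheta (fun s => F s a b c) (D a b c)) (n : ℕ) :
    ∀ a b c : ℤ, a + b + c = n → IsTheta (fun s => F s a b c) (D a b c) := by
  induction n using Nat.strong_induction_on with
  | _ n ih =>
    intro a b c h
    rcases le_or_gt n 2 with h2 | h2
    · exact h0 a b c (by omega) (by omega)
    · have L : ∀ a' b' c' : ℤ, 0 ≤ a' + b' + c' → a' + b' + c' < n →
          IsTheta (fun s => F s a' b' c') (D a' b' c') := fun a' b' c' h0 h1 =>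
        ih (a' + b' + c').toNat (by omega) a' b' c' (by omega)
      obtain ⟨a, rfl⟩ : ∃ a', a = a' + 1 := ⟨a - 1, by ring⟩
      obtain ⟨b, rfl⟩ : ∃ b', b = b' + 1 := ⟨b - 1, by ring⟩
      obtain ⟨c, rfl⟩ : ∃ c', c = c' + 1 := ⟨c - 1, by ring⟩
      have key := (((((L a (b + 1) (c + 1) (by omega) (by omega)).mul
        (L (a + 1) b c (by omega) (by omega))).add
        ((L (a + 1) b (c + 1) (by omega) (by omega)).mul
        (L a (b + 1) c (by omega) (by omega)))).add
        ((L (a + 1) (b + 1) c (by omega) (by omega)).mul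
        (L a b (c + 1) (by omega) (by omega)))).mul (L a b c (by omega) (by omega)).inv)
      rw [← hD a b c (by omega), add_neg_cancel_right] at key
      refine key.congr fun s hs => ?_
      rw [← (hF s hs).step a b c (by omega),
        mul_inv_cancel_right₀ ((hF s hs).ne_zero a b c (by omega))]

/-- Truncation of an integer to `[-1, 2]`. -/
def clamp (r : ℤ) : ℤ := max (-1) (min r 2)

theorem clamp_facts (r : ℤ) : (clamp r < 0 ↔ r < 0) ∧ (clamp r = 0 ↔ r = 0) ∧
    (clamp r = 1 ↔ r = 1) ∧ (0 ≤ clamp r ↔ 0 ≤ r) ∧ (1 ≤ clamp r ↔ 1 ≤ r) ∧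
    (2 ≤ clamp r ↔ 2 ≤ r) := by
  unfold clamp
  omega

theorem clamp_neg (r : ℤ) : clamp r < 0 ↔ r < 0 := (clamp_facts r).1
theorem clamp_eq_zero (r : ℤ) : clamp r = 0 ↔ r = 0 := (clamp_facts r).2.1
theorem clamp_eq_one (r : ℤ) : clamp r = 1 ↔ r = 1 := (clamp_facts r).2.2.1
theorem zero_le_clamp (r : ℤ) : 0 ≤ clamp r ↔ 0 ≤ r := (clamp_facts r).2.2.2.1
theorem one_le_clamp (r : ℤ) : 1 ≤ clamp r ↔ 1 ≤ r := (clamp_facts r).2.2.2.2.1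
theorem two_le_clamp (r : ℤ) : 2 ≤ clamp r ↔ 2 ≤ r := (clamp_facts r).2.2.2.2.2

/-- The tropical recurrence for a function of truncated coordinates, on the levels `≥ -t`. -/
def ClampTrop (g : ℤ → ℤ → ℤ → ℤ) (t : ℤ) : Prop :=
  ∀ i ∈ Finset.Icc (-2 : ℤ) 2, ∀ j ∈ Finset.Icc (-2 : ℤ) 2, ∀ k ∈ Finset.Icc (-2 : ℤ) 2,
    (i = -2 ∨ j = -2 ∨ k = -2 ∨ 0 ≤ i + j + k + t) →
    g (clamp (i + 1)) (clamp (j + 1)) (clamp (k + 1)) + g (clamp i) (clamp j) (clamp k) =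
    max (max (g (clamp i) (clamp (j + 1)) (clamp (k + 1)) + g (clamp (i + 1)) (clamp j) (clamp k))
      (g (clamp (i + 1)) (clamp j) (clamp (k + 1)) + g (clamp i) (clamp (j + 1)) (clamp k)))
      (g (clamp (i + 1)) (clamp (j + 1)) (clamp k) + g (clamp i) (clamp j) (clamp (k + 1)))

/-- A coordinate `r` is replaced by a representative in `[-2, 2]` with the same truncations of `r`
and `r + 1`, which leaves a finite check. The level condition survives: if no representative is
`-2`, all are at least `-1`, so one representative `2` makes the sum nonnegative; if none is
truncated, the sum is the true one. -/
theorem ClampTrop.isTrop {g : ℤ → ℤ → ℤ → ℤ} {u v w : ℤ} (h : ClampTrop g (u + v + w))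
    (h0 : 0 ≤ u + v + w) :
    IsTrop fun a b c => g (clamp (a - u)) (clamp (b - v)) (clamp (c - w)) := by
  intro a b c habc
  have key : ∀ r : ℤ, ∃ i ∈ Finset.Icc (-2 : ℤ) 2, clamp r = clamp i ∧ clamp (r + 1) = clamp (i + 1) ∧
      (i = -2 ∨ i = 2 ∧ 2 ≤ r ∨ i = r ∧ -1 ≤ r) := by
    intro r
    refine ⟨max (-2) (min r 2), ?_, ?_, ?_, ?_⟩
    · rw [Finset.mem_Icc]; omega
    · unfold clamp; omega
    · unfold clamp; omega
    · omega
  obtain ⟨i, hi, i1, i2, i3⟩ := key (a - u)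
  obtain ⟨j, hj, j1, j2, j3⟩ := key (b - v)
  obtain ⟨k, hk, k1, k2, k3⟩ := key (c - w)
  have := h i hi j hj k hk (by rw [Finset.mem_Icc] at hi hj hk; omega)
  simp only [add_sub_right_comm, i1, i2, j1, j2, k1, k2]
  exact this

/-- Tropical evolution of `-δ_0`, in truncated coordinates. -/
def negDelta (i j k : ℤ) : ℤ :=
  if 1 ≤ i ∧ 1 ≤ j ∧ 1 ≤ k then 1 else if i = 0 ∧ j = 0 ∧ k = 0 then -1 else 0

/-- Tropical evolution of `δ_0` for a point on level `0`, in truncated coordinates. -/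
def delta₀ (i j k : ℤ) : ℤ :=
  if 2 ≤ i ∧ 2 ≤ j ∧ 2 ≤ k then 1 else if i = 0 ∧ j = 0 ∧ k = 0 then 1
  else if i = 1 ∧ j = 1 ∧ k = 1 then -1 else 0

/-- Tropical evolution of `δ_0` for a point on level `1`, in truncated coordinates. -/
def delta₁ (i j k : ℤ) : ℤ :=
  if i < 0 ∨ j < 0 ∨ k < 0 then 0 else if i = 0 ∧ j = 0 ∧ k = 0 then 1
  else if i = 0 ∧ j = 0 ∨ i = 0 ∧ k = 0 ∨ j = 0 ∧ k = 0 then 0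
  else if i = 0 ∨ j = 0 ∨ k = 0 then 1
  else if i = 1 ∧ j = 1 ∧ k = 1 then 0
  else if i = 1 ∨ j = 1 ∨ k = 1 then 2 else 4

/-- Tropical evolution of `δ_0` for a point on level `2`, in truncated coordinates. -/
def delta₂ (i j k : ℤ) : ℤ := if 0 ≤ i ∧ 0 ≤ j ∧ 0 ≤ k then 1 else 0

set_option maxRecDepth 100000 in
theorem clampTrop_negDelta : ∀ t ∈ Finset.Icc (0 : ℤ) 2, ClampTrop negDelta t := by
  unfold ClampTrop
  decide

set_option maxRecDepth 100000 in
theorem clampTrop_delta₀ : ClampTrop delta₀ 0 := by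
  unfold ClampTrop
  decide

set_option maxRecDepth 100000 in
theorem clampTrop_delta₁ : ClampTrop delta₁ 1 := by
  unfold ClampTrop
  decide

set_option maxRecDepth 100000 in
theorem clampTrop_delta₂ : ClampTrop delta₂ 2 := by
  unfold ClampTrop
  decide

/-- The tropical evolution of `± δ_w` is bounded, supported in the octant `≥ w`, and zero
unless `w` is on one of the levels `0, 1, 2`. -/
theorem exists_isTrop_delta (u v w : ℤ) {σ : ℤ} (hσ : σ = 1 ∨ σ = -1) :
    ∃ D : ℤ → ℤ → ℤ → ℤ, IsTrop D ∧ (∀ a b c, 0 ≤ a + b + c → a + b + c ≤ 2 →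
      D a b c = if a = u ∧ b = v ∧ c = w then σ else 0) ∧
      ∀ a b c, |D a b c| ≤ 4 ∧
        (¬ (u ≤ a ∧ v ≤ b ∧ w ≤ c ∧ 0 ≤ u + v + w ∧ u + v + w ≤ 2) → D a b c = 0) := by
  by_cases hL : 0 ≤ u + v + w ∧ u + v + w ≤ 2
  · have key : ∀ g : ℤ → ℤ → ℤ → ℤ, ClampTrop g (u + v + w) →
        (∀ a b c, 0 ≤ a + b + c → a + b + c ≤ 2 → g (clamp (a - u)) (clamp (b - v)) (clamp (c - w)) =
          if a = u ∧ b = v ∧ c = w then σ else 0) →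
        (∀ i j k, |g i j k| ≤ 4 ∧ (i < 0 ∨ j < 0 ∨ k < 0 → g i j k = 0)) →
        ∃ D : ℤ → ℤ → ℤ → ℤ, IsTrop D ∧ (∀ a b c, 0 ≤ a + b + c → a + b + c ≤ 2 →
        D a b c = if a = u ∧ b = v ∧ c = w then σ else 0) ∧
        ∀ a b c, |D a b c| ≤ 4 ∧
          (¬ (u ≤ a ∧ v ≤ b ∧ w ≤ c ∧ 0 ≤ u + v + w ∧ u + v + w ≤ 2) → D a b c = 0) := by
      intro g hg h0 h4
      refine ⟨_, hg.isTrop hL.1, h0, fun a b c => ⟨(h4 _ _ _).1, fun h => (h4 _ _ _).2 ?_⟩⟩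
      simp only [clamp_neg]
      omega
    rcases hσ with rfl | rfl
    · obtain h | h | h : u + v + w = 0 ∨ u + v + w = 1 ∨ u + v + w = 2 := by omega
      · refine key delta₀ (h ▸ clampTrop_delta₀) (fun a b c h1 h2 => ?_) fun i j k => ?_
        · simp only [delta₀, clamp_eq_zero, clamp_eq_one, two_le_clamp, sub_eq_zero]
          split_ifs <;> omega
        · simp only [delta₀, abs_le]
          split_ifs <;> omega
      · refine key delta₁ (h ▸ clampTrop_delta₁) (fun a b c h1 h2 => ?_) fun i j k => ?_
        · simp only [delta₁, clamp_neg, clamp_eq_zero, clamp_eq_one, sub_eq_zero, sub_neg]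
          split_ifs <;> omega
        · simp only [delta₁, abs_le]
          split_ifs <;> omega
      · refine key delta₂ (h ▸ clampTrop_delta₂) (fun a b c h1 h2 => ?_) fun i j k => ?_
        · simp only [delta₂, zero_le_clamp]
          split_ifs <;> omega
        · simp only [delta₂, abs_le]
          split_ifs <;> omega
    · refine key negDelta (clampTrop_negDelta _ (Finset.mem_Icc.mpr hL)) (fun a b c h1 h2 => ?_)
        fun i j k => ?_
      · simp only [negDelta, clamp_eq_zero, one_le_clamp, sub_eq_zero]
        split_ifs <;> omega
      · simp only [negDelta, abs_le]
        split_ifs <;> omega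
  · refine ⟨fun _ _ _ => 0, fun _ _ _ _ => by simp, fun a b c h0 h2 => ?_, fun _ _ _ => by simp⟩
    rw [if_neg]
    rintro ⟨rfl, rfl, rfl⟩
    exact hL ⟨h0, h2⟩

theorem evolve_pos {x : P₀ → ℝ} (hx : ∀ v, 0 < x v) (σ : ℤ) (n : ℕ) (v : P₀) :
    0 < evolve x σ n v :=
  evolve_of_closed (P := fun a : ℝ => 0 < a) add_pos mul_pos div_pos hx σ n v

/-- The exponents in the Laurent polynomial `p / x ^ m` for the value at `(a, b, c)`. -/
theorem exponent_bound {a b c : ℤ} (h0 : 0 ≤ a + b + c) {p : MvPolynomial (ℤ × ℤ × ℤ) ℤ}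
    {m : ℤ × ℤ × ℤ →₀ ℕ} (hp : ∀ (F : ℤ → ℤ → ℤ → ℝ) (x : ℤ × ℤ × ℤ → ℝ), IsSol F → IsInit F x →
      F a b c * evalAt x (MvPolynomial.monomial m (1 : ℤ)) = evalAt x p)
    {e : ℤ × ℤ × ℤ →₀ ℤ} (he : e ∈ (quotientPoly id p m).coeff.support) (u v w : ℤ) :
    |e (u, v, w)| ≤ 4 ∧
      (¬ (u ≤ a ∧ v ≤ b ∧ w ≤ c ∧ 0 ≤ u + v + w ∧ u + v + w ≤ 2) → e (u, v, w) = 0) := by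
  classical
  -- The weight `σ` at the single point `(u, v, w)` measures `σ` times the exponent there, so the
  -- two signs bound it from above and from below.
  have key : ∀ σ : ℤ, σ = 1 ∨ σ = -1 → ∃ d : ℤ, e (u, v, w) * σ ≤ d ∧ |d| ≤ 4 ∧
      (¬ (u ≤ a ∧ v ≤ b ∧ w ≤ c ∧ 0 ≤ u + v + w ∧ u + v + w ≤ 2) → d = 0) := by
    intro σ hσ
    obtain ⟨D, hD, hD0, hD4⟩ := exists_isTrop_delta u v w hσ
    refine ⟨D a b c, ?_, hD4 a b c⟩
    rw [← weight_single]
    refine weight_le_of_evalAt_le _ _ _ (fun y hy => ?_) he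
    set ω : ℤ × ℤ × ℤ → ℤ := Pi.single (u, v, w) σ
    have hx : ∀ s : ℝ, 1 ≤ s → ∀ q, 0 < y q * s ^ ω q := fun s hs q =>
      mul_pos (hy q) (zpow_pos (by linarith) _)
    have hF : ∀ s : ℝ, 1 ≤ s → IsSol (solution fun v => y (lift v) * s ^ ω (lift v)) := fun s hs =>
      isSol_solution fun n v => (evolve_pos (fun v => hx s hs (lift v)) 1 n v).ne'
    have hI : ∀ s : ℝ, ∀ a b c, 0 ≤ a + b + c → a + b + c ≤ 2 →
        y (a, b, c) * s ^ ω (a, b, c) =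
          solution (fun v => y (lift v) * s ^ ω (lift v)) a b c := fun s a b c h0 h2 => by
      rw [solution_init _ _ _ _ h2, lift_proj _ _ _ h0 h2]
    obtain ⟨c', C, hc', hC, h⟩ := isTheta_of_isTrop hF hD (fun a b c h0 h2 => by
      simp only [← hI _ a b c h0 h2]
      rw [hD0 a b c h0 h2]
      have : (if a = u ∧ b = v ∧ c = w then σ else 0) = ω (a, b, c) := by
        simp only [ω, Pi.single_apply, Prod.mk.injEq]
      rw [this]
      exact IsTheta.const_mul_zpow (hy _) _) (a + b + c).toNat a b c (by omega)
    refine ⟨C, fun s hs => ?_⟩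
    have hne : ∀ q, y q * s ^ ω q ≠ 0 := fun q => (hx s hs q).ne'
    have e1 := evalAt_quotientPoly hne id p m
    have e2 := hp _ _ (hF s hs) ⟨hI s, hne⟩
    have e3 := mul_right_cancel₀ (evalAt_monomial_ne_zero hne m) (e1.trans e2.symm)
    obtain ⟨h1, h2⟩ := h s hs
    have hs0 : 0 < s := by linarith
    rw [e3, abs_of_nonneg (le_trans (by positivity) h1)]
    exact h2
  obtain ⟨d, h1, h2, h3⟩ := key 1 (Or.inl rfl)
  obtain ⟨d', h1', h2', h3'⟩ := key (-1) (Or.inr rfl)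
  rw [abs_le] at *
  refine ⟨by omega, fun h => ?_⟩
  have := h3 h
  have := h3' h
  omega

end CubeRecurrence

/-! ### Quadratic growth of the tropical recurrence on a finite abelian group -/

namespace CubeRecurrence

section Torus

variable {T : Type} [AddCommGroup T]

/-- The tropical cube recurrence on an abelian group, all three residues of time being treated
independently. -/
def IsTropEvolution (e₁ e₂ e₃ : T) (D : ℕ → T → ℤ) : Prop :=
  ∀ t τ, D (t + 3) τ + D t τ =
    max (max (D (t + 2) (τ + e₁) + D (t + 1) (τ - e₁)) (D (t + 2) (τ + e₂) + D (t + 1) (τ - e₂)))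
      (D (t + 2) (τ + e₃) + D (t + 1) (τ - e₃))

/-- The solution of the tropical cube recurrence with initial values `x`. -/
def tropEvolve (e₁ e₂ e₃ : T) (x : ℕ → T → ℤ) : ℕ → T → ℤ
  | 0 => x 0
  | 1 => x 1
  | 2 => x 2
  | t + 3 => fun τ =>
      max (max (tropEvolve e₁ e₂ e₃ x (t + 2) (τ + e₁) + tropEvolve e₁ e₂ e₃ x (t + 1) (τ - e₁))
        (tropEvolve e₁ e₂ e₃ x (t + 2) (τ + e₂) + tropEvolve e₁ e₂ e₃ x (t + 1) (τ - e₂)))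
        (tropEvolve e₁ e₂ e₃ x (t + 2) (τ + e₃) + tropEvolve e₁ e₂ e₃ x (t + 1) (τ - e₃)) -
      tropEvolve e₁ e₂ e₃ x t τ

theorem isTropEvolution_tropEvolve (e₁ e₂ e₃ : T) (x : ℕ → T → ℤ) :
    IsTropEvolution e₁ e₂ e₃ (tropEvolve e₁ e₂ e₃ x) := by
  intro t τ
  rw [tropEvolve, sub_add_cancel]

/-- The three terms of the tropical recurrence agree everywhere at time `t`. -/
def IsFlat (e₁ e₂ e₃ : T) (D : ℕ → T → ℤ) (t : ℕ) : Prop :=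
  ∀ τ, D (t + 2) (τ + e₁) + D (t + 1) (τ - e₁) = D (t + 2) (τ + e₂) + D (t + 1) (τ - e₂) ∧
    D (t + 2) (τ + e₁) + D (t + 1) (τ - e₁) = D (t + 2) (τ + e₃) + D (t + 1) (τ - e₃)

variable {e₁ e₂ e₃ : T} {D : ℕ → T → ℤ}

theorem IsFlat.step {t : ℕ} (hD : IsTropEvolution e₁ e₂ e₃ D) (h : IsFlat e₁ e₂ e₃ D t) (τ : T) :
    D (t + 3) τ + D t τ = D (t + 2) (τ + e₁) + D (t + 1) (τ - e₁) ∧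
    D (t + 3) τ + D t τ = D (t + 2) (τ + e₂) + D (t + 1) (τ - e₂) ∧
    D (t + 3) τ + D t τ = D (t + 2) (τ + e₃) + D (t + 1) (τ - e₃) := by
  have := hD t τ
  have := h τ
  omega

/-- Flatness propagates backward in time. -/
theorem IsFlat.prev (he : e₁ + e₂ + e₃ = 0) (hD : IsTropEvolution e₁ e₂ e₃ D) {t : ℕ}
    (h1 : IsFlat e₁ e₂ e₃ D (t + 1)) (h2 : IsFlat e₁ e₂ e₃ D (t + 2)) : IsFlat e₁ e₂ e₃ D t := by
  -- Flatness at `t + 1` allows the recurrence to be read in the direction `c`, at `τ - a` and at `τ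
  -- - b`. As `a + b + c = 0`, the two identities involve the points `τ + b` and `τ + a`, and their
  -- difference is reduced by flatness at `t + 2` at the point `τ + c`.
  have key : ∀ a b c : T, a + b + c = 0 →
      (∀ τ, D (t + 4) τ + D (t + 1) τ = D (t + 3) (τ + c) + D (t + 2) (τ - c)) →
      (∀ τ, D (t + 4) (τ + a) + D (t + 3) (τ - a) = D (t + 4) (τ + b) + D (t + 3) (τ - b)) →
      ∀ τ, D (t + 2) (τ + a) + D (t + 1) (τ - a) = D (t + 2) (τ + b) + D (t + 1) (τ - b) := by
    intro a b c habc h3 h4 τ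
    have p1 := h3 (τ - a)
    have p2 := h3 (τ - b)
    have p3 := h4 (τ + c)
    rw [show τ - a - c = τ + b by rw [← sub_eq_zero, ← neg_eq_zero, ← habc]; abel] at p1
    rw [show τ - b - c = τ + a by rw [← sub_eq_zero, ← neg_eq_zero, ← habc]; abel] at p2
    rw [show τ + c + a = τ - b by rw [← sub_eq_zero, ← habc]; abel,
      show τ + c + b = τ - a by rw [← sub_eq_zero, ← habc]; abel,
      show τ + c - a = τ - a + c by abel, show τ + c - b = τ - b + c by abel] at p3
    omega
  have s := h1.step hD
  refine fun τ => ⟨key e₁ e₂ e₃ he (fun τ => (s τ).2.2) (fun τ => (h2 τ).1) τ,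
    key e₁ e₃ e₂ (by rw [← he]; abel) (fun τ => (s τ).2.1) (fun τ => (h2 τ).2) τ⟩

theorem not_isFlat_or (he : e₁ + e₂ + e₃ = 0) (hD : IsTropEvolution e₁ e₂ e₃ D)
    (h : ¬ (IsFlat e₁ e₂ e₃ D 0 ∧ IsFlat e₁ e₂ e₃ D 1)) (t : ℕ) :
    ¬ (IsFlat e₁ e₂ e₃ D t ∧ IsFlat e₁ e₂ e₃ D (t + 1)) := by
  induction t with
  | zero => exact h
  | succ t ih => exact fun ⟨h1, h2⟩ => ih ⟨h1.prev he hD h2, h1⟩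

/-- Values do not decrease by more than `1` in the directions `-eᵢ`. -/
theorem le_add_one (hD : IsTropEvolution e₁ e₂ e₃ D)
    (h : ∀ τ e, D 0 τ ≤ D 1 (τ - e) + 1 ∧ D 1 τ ≤ D 2 (τ - e) + 1) (t : ℕ) :
    ∀ τ, D t τ ≤ D (t + 1) (τ - e₁) + 1 ∧ D t τ ≤ D (t + 1) (τ - e₂) + 1 ∧
      D t τ ≤ D (t + 1) (τ - e₃) + 1 := by
  induction t using Nat.twoStepInduction with
  | zero => exact fun τ => ⟨(h τ _).1, (h τ _).1, (h τ _).1⟩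
  | one => exact fun τ => ⟨(h τ _).2, (h τ _).2, (h τ _).2⟩
  | more t ih _ =>
    intro τ
    change D (t + 2) τ ≤ D (t + 3) _ + 1 ∧ D (t + 2) τ ≤ D (t + 3) _ + 1 ∧
      D (t + 2) τ ≤ D (t + 3) _ + 1
    -- The term in direction `e` of the recurrence at `τ - e` gives `D (t + 3) (τ - e) ≥ D (t + 2) τ
    -- + D (t + 1) (τ - e - e) - D t (τ - e)`. The last two terms together are at least `-1` by the
    -- hypothesis at time `t`.
    have s1 := hD t (τ - e₁)
    have s2 := hD t (τ - e₂)
    have s3 := hD t (τ - e₃)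
    have i1 := ih (τ - e₁)
    have i2 := ih (τ - e₂)
    have i3 := ih (τ - e₃)
    rw [sub_add_cancel] at s1 s2 s3
    omega

theorem le_add_steps (hD : IsTropEvolution e₁ e₂ e₃ D)
    (h : ∀ τ e, D 0 τ ≤ D 1 (τ - e) + 1 ∧ D 1 τ ≤ D 2 (τ - e) + 1) (t : ℕ) (τ : T) (a b c : ℕ) :
    D t τ ≤ D (t + (a + b + c)) (τ - (a • e₁ + b • e₂ + c • e₃)) + (a + b + c : ℕ) := by
  have L := le_add_one hD h
  induction a with
  | succ a ih =>
    have := (L (t + (a + b + c)) (τ - (a • e₁ + b • e₂ + c • e₃))).1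
    rw [show t + (a + b + c) + 1 = t + (a + 1 + b + c) by ring,
      show τ - (a • e₁ + b • e₂ + c • e₃) - e₁ = τ - ((a + 1) • e₁ + b • e₂ + c • e₃) by
        rw [succ_nsmul]; abel] at this
    omega
  | zero =>
    induction b with
    | succ b ih =>
      have := (L (t + (0 + b + c)) (τ - (0 • e₁ + b • e₂ + c • e₃))).2.1
      rw [show t + (0 + b + c) + 1 = t + (0 + (b + 1) + c) by ring,
        show τ - (0 • e₁ + b • e₂ + c • e₃) - e₂ = τ - (0 • e₁ + (b + 1) • e₂ + c • e₃) by
          rw [succ_nsmul]; abel] at this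
      omega
    | zero =>
      induction c with
      | succ c ih =>
        have := (L (t + (0 + 0 + c)) (τ - (0 • e₁ + 0 • e₂ + c • e₃))).2.2
        rw [show t + (0 + 0 + c) + 1 = t + (0 + 0 + (c + 1)) by ring,
          show τ - (0 • e₁ + 0 • e₂ + c • e₃) - e₃ = τ - (0 • e₁ + 0 • e₂ + (c + 1) • e₃) by
            rw [succ_nsmul]; abel] at this
        omega
      | zero => simp

/-- The three residues of time evolve independently, and only the points with color `t` carry data
at time `t`. This makes points of the other colors harmless in sums over the torus. -/
theorem support_color (he : e₁ + e₂ + e₃ = 0) (hD : IsTropEvolution e₁ e₂ e₃ D) (χ : T →+ ZMod 3)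
    (h1 : χ e₁ = 2) (h2 : χ e₂ = 2)
    (h : ∀ t : ℕ, t < 3 → ∀ τ, χ τ ≠ (t : ZMod 3) → D t τ = 0) (t : ℕ) :
    ∀ τ, χ τ ≠ (t : ZMod 3) → D t τ = 0 := by
  have h3 : χ e₃ = 2 := by
    have := congrArg χ he
    rw [map_add, map_add, h1, h2, map_zero] at this
    have e : χ e₃ = (2 + 2 + χ e₃) - (2 + 2) := by ring
    rw [e, this]
    decide
  induction t using Nat.strong_induction_on with
  | _ t ih =>
    intro τ hτ
    rcases lt_or_ge t 3 with ht | ht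
    · exact h t ht τ hτ
    · obtain ⟨t, rfl⟩ : ∃ s, t = s + 3 := ⟨t - 3, by omega⟩
      have c3 : ((t + 3 : ℕ) : ZMod 3) = t := by
        push_cast
        rw [show (3 : ZMod 3) = 0 by decide, add_zero]
      rw [c3] at hτ
      have p : ∀ e : T, χ e = 2 → D (t + 2) (τ + e) = 0 ∧ D (t + 1) (τ - e) = 0 := by
        intro e he
        constructor
        · refine ih _ (by omega) _ fun hc => hτ ?_
          rw [map_add, he] at hc
          push_cast at hc
          exact add_right_cancel hc
        · refine ih _ (by omega) _ fun hc => hτ ?_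
          rw [map_sub, he, sub_eq_iff_eq_add] at hc
          push_cast at hc
          rw [hc, add_assoc, show (1 + 2 : ZMod 3) = 0 by decide, add_zero]
      have s := hD t τ
      rw [(p e₁ h1).1, (p e₁ h1).2, (p e₂ h2).1, (p e₂ h2).2, (p e₃ h3).1, (p e₃ h3).2,
        ih t (by omega) τ hτ] at s
      simpa using s

variable [Fintype T]

/-- The maximum is at least the mean of the three terms, with equality everywhere only in the flat
case, and sums over the group are translation invariant. Integrality improves a positive difference
to `1`. -/
theorem sum_second_difference_nonneg (hD : IsTropEvolution e₁ e₂ e₃ D) (t : ℕ) :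
    0 ≤ ∑ τ, D (t + 3) τ - ∑ τ, D (t + 2) τ - ∑ τ, D (t + 1) τ + ∑ τ, D t τ ∧
    (¬ IsFlat e₁ e₂ e₃ D t →
      1 ≤ ∑ τ, D (t + 3) τ - ∑ τ, D (t + 2) τ - ∑ τ, D (t + 1) τ + ∑ τ, D t τ) := by
  have a : ∀ (e : T) (f : T → ℤ), ∑ τ, f (τ + e) = ∑ τ, f τ := fun e f =>
    Equiv.sum_comp (Equiv.addRight e) f
  have b : ∀ (e : T) (f : T → ℤ), ∑ τ, f (τ - e) = ∑ τ, f τ := fun e f =>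
    Equiv.sum_comp (Equiv.subRight e) f
  let φ : T → ℤ := fun τ => 3 * (D (t + 3) τ + D t τ) -
    (D (t + 2) (τ + e₁) + D (t + 1) (τ - e₁) + (D (t + 2) (τ + e₂) + D (t + 1) (τ - e₂)) +
      (D (t + 2) (τ + e₃) + D (t + 1) (τ - e₃)))
  have hφ : ∑ τ, φ τ =
      3 * (∑ τ, D (t + 3) τ - ∑ τ, D (t + 2) τ - ∑ τ, D (t + 1) τ + ∑ τ, D t τ) := by
    simp only [φ, Finset.sum_sub_distrib, Finset.sum_add_distrib, ← Finset.mul_sum, a, b]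
    ring
  have h0 : ∀ τ ∈ Finset.univ, 0 ≤ φ τ := by
    intro τ _
    have := hD t τ
    simp only [φ]
    omega
  refine ⟨by have := Finset.sum_nonneg h0; omega, fun hf => ?_⟩
  have : 0 < ∑ τ, φ τ := by
    refine Finset.sum_pos' h0 ?_
    by_contra! H
    refine hf fun τ => ?_
    have := hD t τ
    have := H τ (Finset.mem_univ τ)
    simp only [φ] at this
    omega
  omega

/-- The sum over the torus grows quadratically. -/
theorem exists_quadratic_le_sum (he : e₁ + e₂ + e₃ = 0) (hD : IsTropEvolution e₁ e₂ e₃ D)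
    (h : ¬ (IsFlat e₁ e₂ e₃ D 0 ∧ IsFlat e₁ e₂ e₃ D 1)) :
    ∃ C : ℕ, ∀ k r : ℕ, r < 2 → (k : ℤ) ^ 2 - C * k - C ≤ 2 * ∑ τ, D (2 * k + r) τ := by
  set S : ℕ → ℤ := fun t => ∑ τ, D t τ
  have hS : ∀ t, S t + 1 ≤ S (t + 4) - 2 * S (t + 2) + 2 * S t := by
    -- Adding the inequalities for `t` and `t + 1` cancels the odd steps and leaves the second
    -- difference of `S` with step `2`; at least one of the two is strict.
    intro t
    obtain ⟨h1, h2⟩ := sum_second_difference_nonneg hD t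
    obtain ⟨h3, h4⟩ := sum_second_difference_nonneg hD (t + 1)
    have : ¬ IsFlat e₁ e₂ e₃ D t ∨ ¬ IsFlat e₁ e₂ e₃ D (t + 1) :=
      not_and_or.mp (not_isFlat_or he hD h t)
    change 0 ≤ S (t + 3) - S (t + 2) - S (t + 1) + S t at h1
    change _ → 1 ≤ S (t + 3) - S (t + 2) - S (t + 1) + S t at h2
    change 0 ≤ S (t + 4) - S (t + 3) - S (t + 2) + S (t + 1) at h3
    change _ → 1 ≤ S (t + 4) - S (t + 3) - S (t + 2) + S (t + 1) at h4
    rcases this with h5 | h5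
    · have := h2 h5
      omega
    · have := h4 h5
      omega
  have key : ∀ r k : ℕ, (S (r + 2) - S r) + k ≤ S (2 * k + r + 2) - S (2 * k + r) ∧
      (k : ℤ) ^ 2 - k + 2 * (S (r + 2) - S r) * k + 2 * S r ≤ 2 * S (2 * k + r) := by
    intro r k
    induction k with
    | zero => simp
    | succ k ih =>
      have := hS (2 * k + r)
      rw [show 2 * (k + 1) + r + 2 = 2 * k + r + 4 by ring,
        show 2 * (k + 1) + r = 2 * k + r + 2 by ring]
      push_cast
      constructor
      · omega
      · nlinarith [ih.1, ih.2]
  have hb : ∀ r : ℕ, ∃ C : ℕ, ∀ k : ℕ, (k : ℤ) ^ 2 - C * k - C ≤ 2 * S (2 * k + r) := by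
    intro r
    refine ⟨(1 + 2 * |S (r + 2) - S r| + 2 * |S r|).toNat, fun k => ?_⟩
    rw [Int.toNat_of_nonneg (by positivity)]
    have h1 := (key r k).2
    have h2 := neg_abs_le (S (r + 2) - S r)
    have h3 := neg_abs_le (S r)
    have h4 := abs_nonneg (S (r + 2) - S r)
    have h5 := abs_nonneg (S r)
    have hk : (0 : ℤ) ≤ k := by positivity
    nlinarith [mul_le_mul_of_nonneg_right h2 hk, mul_nonneg h5 hk]
  obtain ⟨C₀, h₀⟩ := hb 0
  obtain ⟨C₁, h₁⟩ := hb 1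
  refine ⟨C₀ + C₁, fun k r hr => ?_⟩
  have p0 := h₀ k
  have p1 := h₁ k
  have q0 : (0 : ℤ) ≤ C₀ * k := by positivity
  have q1 : (0 : ℤ) ≤ C₁ * k := by positivity
  change _ ≤ 2 * S (2 * k + r)
  push_cast
  interval_cases r <;> linarith

/-- Points of the same color are connected by paths of one and the same length. -/
theorem exists_steps (he : e₁ + e₂ + e₃ = 0) (χ : T →+ ZMod 3) (h1 : χ e₁ = 2) (h2 : χ e₂ = 2)
    (hgen : ∀ τ : T, ∃ i j : ℤ, τ = i • e₁ + j • e₂) {σ τ : T} (h : χ σ = χ τ) :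
    ∃ a b c : ℕ, a + b + c = 9 * Fintype.card T ∧ τ = σ - (a • e₁ + b • e₂ + c • e₃) := by
  obtain ⟨i, j, hij⟩ := hgen (σ - τ)
  set N := Fintype.card T
  have hN : 0 < N := Fintype.card_pos
  have hNs : ∀ x : T, (3 * (N : ℤ)) • x = 0 := fun x => by
    rw [mul_smul, natCast_zsmul, card_nsmul_eq_zero, smul_zero]
  have hχ : ((i + j : ℤ) : ZMod 3) = 0 := by
    have := congrArg χ hij
    rw [map_sub, h, sub_self, map_add, map_zsmul, map_zsmul, h1, h2] at this
    simp only [zsmul_eq_mul] at this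
    push_cast
    have h6 : (i + j : ZMod 3) * 2 = 0 := by rw [add_mul]; exact this.symm
    have h4 : (i + j : ZMod 3) * 2 * 2 = 0 := by rw [h6, zero_mul]
    rw [mul_assoc, show (2 * 2 : ZMod 3) = 1 by decide, mul_one] at h4
    exact h4
  rw [ZMod.intCast_zmod_eq_zero_iff_dvd] at hχ
  -- The order `N` kills the group, and reduction modulo `3 * N` rather than `N` also keeps the
  -- residue modulo `3`.
  have m : ∀ i : ℤ, ∃ a : ℕ, (a : ℤ) < 3 * N ∧ (3 : ℤ) ∣ a - i ∧ ∀ x : T, a • x = i • x := by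
    intro i
    refine ⟨(i % (3 * N)).toNat, ?_⟩
    have hp : 0 ≤ i % (3 * N) := Int.emod_nonneg _ (by omega)
    rw [Int.toNat_of_nonneg hp]
    refine ⟨Int.emod_lt_of_pos _ (by omega), ?_, fun x => ?_⟩
    · rw [Int.emod_def]
      exact ⟨-(N * (i / (3 * N))), by ring⟩
    · rw [← natCast_zsmul, Int.toNat_of_nonneg hp, Int.emod_def, sub_smul, mul_comm, mul_smul, hNs,
        smul_zero, sub_zero]
  obtain ⟨a, ha, ha3, hax⟩ := m i
  obtain ⟨b, hb, hb3, hbx⟩ := m j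
  -- Since `e₁ + e₂ + e₃ = 0`, closed triples of steps pad every path to the common length `9 * N`;
  -- equality of colors makes the missing length divisible by `3`.
  obtain ⟨k, hk⟩ : ∃ k : ℕ, a + b + 3 * k = 9 * N := ⟨(9 * N - (a + b)) / 3, by
    push_cast at hχ
    omega⟩
  refine ⟨a + k, b + k, k, by omega, ?_⟩
  have e : (a + k) • e₁ + (b + k) • e₂ + k • e₃ = a • e₁ + b • e₂ + k • (e₁ + e₂ + e₃) := by
    simp only [add_smul, smul_add]
    abel
  rw [e, he, smul_zero, add_zero, hax, hbx, ← hij, sub_sub_cancel]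

/-- The values themselves grow at least quadratically. -/
theorem exists_quadratic_le (he : e₁ + e₂ + e₃ = 0) (hD : IsTropEvolution e₁ e₂ e₃ D)
    (χ : T →+ ZMod 3) (h1 : χ e₁ = 2) (h2 : χ e₂ = 2)
    (hgen : ∀ τ : T, ∃ i j : ℤ, τ = i • e₁ + j • e₂)
    (hnf : ¬ (IsFlat e₁ e₂ e₃ D 0 ∧ IsFlat e₁ e₂ e₃ D 1))
    (hsupp : ∀ t : ℕ, t < 3 → ∀ τ, χ τ ≠ (t : ZMod 3) → D t τ = 0)
    (hinit : ∀ τ e, D 0 τ ≤ D 1 (τ - e) + 1 ∧ D 1 τ ≤ D 2 (τ - e) + 1) :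
    ∃ c : ℝ, 0 < c ∧ ∃ t₀ : ℕ, ∀ t ≥ t₀, ∀ τ, χ τ = (t : ZMod 3) →
      c * (t : ℝ) ^ 2 ≤ (D t τ : ℝ) := by
  obtain ⟨C, hC⟩ := exists_quadratic_le_sum he hD hnf
  set N := Fintype.card T with hNdef
  have hN : 0 < N := Fintype.card_pos
  -- With `s = t - 9 * N` about `2 * k`, the sum at time `s` is at least `k ^ 2 / 4`, and `k ≥ t /
  -- 3`, so it is at least `t ^ 2 / 36`. Each value at time `t` plus `9 * N` is at least this sum
  -- divided by `N`. The threshold makes `9 * N` at most half of `t ^ 2 / (36 * N)`.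
  refine ⟨1 / (72 * N), by positivity, 27 * N + 6 * C + 6 + 72 * N * (9 * N), fun t ht τ hτ => ?_⟩
  obtain ⟨M, hM⟩ : ∃ M, M = 72 * N * (9 * N) := ⟨_, rfl⟩
  rw [← hM] at ht
  obtain ⟨s, hs⟩ : ∃ s, t = s + 9 * N := ⟨t - 9 * N, by omega⟩
  obtain ⟨k, r, hr, hkr⟩ : ∃ k r : ℕ, r < 2 ∧ s = 2 * k + r :=
    ⟨s / 2, s % 2, Nat.mod_lt _ (by norm_num), by omega⟩
  have hsum := hC k r hr
  rw [← hkr] at hsum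
  -- Every point of the right color at time `s` reaches `τ` in `9 * N` steps, losing at most `1` per
  -- step; at all other points the value is `0`.
  have hle : ∑ σ, D s σ ≤ N * max 0 (D t τ + 9 * N) := by
    rw [hNdef, ← Finset.card_univ, ← nsmul_eq_mul]
    refine Finset.sum_le_card_nsmul _ _ _ fun σ _ => ?_
    by_cases hσ : χ σ = (s : ZMod 3)
    · have e : χ σ = χ τ := by
        rw [hσ, hτ, hs]
        push_cast
        rw [show (9 : ZMod 3) = 0 by decide, zero_mul, add_zero]
      obtain ⟨a, b, c, habc, rfl⟩ := exists_steps he χ h1 h2 hgen e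
      have := le_add_steps hD hinit s σ a b c
      rw [habc, ← hNdef, ← hs] at this
      push_cast at this
      exact this.trans (le_max_right _ _)
    · rw [support_color he hD χ h1 h2 hsupp s σ hσ]
      exact le_max_left _ _
  have hkt : (t : ℤ) ≤ 3 * k := by omega
  have hkC : (2 * C + 2 : ℤ) ≤ k := by omega
  have ht0 : (72 * N * (9 * N) + 1 : ℤ) ≤ t := by
    have : M + 1 ≤ t := by omega
    rw [hM] at this
    exact_mod_cast this
  have hk2 : (k : ℤ) ^ 2 ≤ 4 * ∑ σ, D s σ := by nlinarith
  have ht2 : (t : ℤ) ^ 2 ≤ 36 * ∑ σ, D s σ := by nlinarith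
  have hpos : 0 < D t τ + 9 * N := by
    by_contra! hneg
    rw [max_eq_left hneg, mul_zero] at hle
    nlinarith [sq_nonneg (t : ℤ)]
  rw [max_eq_right hpos.le] at hle
  have hfin : (t : ℤ) ^ 2 ≤ 72 * N * D t τ := by nlinarith
  rw [div_mul_eq_mul_div, one_mul, div_le_iff₀ (by positivity)]
  have : ((t : ℝ)) ^ 2 ≤ 72 * N * D t τ := by exact_mod_cast hfin
  linarith

end Torus

end CubeRecurrence

/-! ### The torus: finiteness, colors, initial data and counting of exponents -/

namespace CubeRecurrence

theorem P₀.ext_iff' {v w : P₀} : v = w ↔ v.1.1 = w.1.1 ∧ v.1.2.1 = w.1.2.1 := by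
  constructor
  · rintro rfl
    exact ⟨rfl, rfl⟩
  · rintro ⟨h1, h2⟩
    have hv : v.1.1 + v.1.2.1 + v.1.2.2 = 0 := v.2
    have hw : w.1.1 + w.1.2.1 + w.1.2.2 = 0 := w.2
    exact Subtype.ext (Prod.ext h1 (Prod.ext h2 (by omega)))

theorem eq_smul_e (v : P₀) : v = v.1.1 • e₁₂ + (v.1.1 + v.1.2.1) • e₂₃ := by
  rw [P₀.ext_iff']
  simp [e₁₂, e₂₃]

theorem e_sum : e₁₂ + e₂₃ + e₃₁ = 0 := by
  rw [P₀.ext_iff']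
  simp [e₁₂, e₂₃, e₃₁]

/-- The color as a homomorphism. -/
def colorHom : P₀ →+ ZMod 3 where
  toFun v := ((v.1.2.1 - v.1.2.2 : ℤ) : ZMod 3)
  map_zero' := by simp
  map_add' v w := by
    simp only [AddSubgroup.coe_add, Prod.snd_add, Prod.fst_add]
    push_cast
    ring

theorem colorHom_eq_zero_iff (v : P₀) : colorHom v = 0 ↔ color v = 0 :=
  (ZMod.intCast_zmod_eq_zero_iff_dvd _ 3).trans Int.dvd_iff_emod_eq_zero

theorem colorHom_proj (a b c : ℤ) : colorHom (proj a b c) = ((a + b + c : ℤ) : ZMod 3) := by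
  change ((a - b - (b - c) : ℤ) : ZMod 3) = _
  rw [← sub_eq_zero, ← Int.cast_sub, show a - b - (b - c) - (a + b + c) = 3 * (-b) by ring]
  push_cast
  rw [show (3 : ZMod 3) = 0 by decide, zero_mul]

theorem lift_level (v : P₀) : (lift v).1 + (lift v).2.1 + (lift v).2.2 = color v := by
  have hv : v.1.1 + v.1.2.1 + v.1.2.2 = 0 := v.2
  simp only [lift, color]
  omega

theorem proj_lift (v : P₀) (n : ℤ) :
    proj ((lift v).1 + n) ((lift v).2.1 + n) ((lift v).2.2 + n) = v := by
  rw [P₀.ext_iff']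
  simp only [proj, lift]
  omega

theorem torusCube_eq_solution (A B v : P₀) (n : ℕ) : torusCube A B v (color v + 3 * (n : ℤ)) =
    solution (torusInit A B) ((lift v).1 + n) ((lift v).2.1 + n) ((lift v).2.2 + n) := by
  have h := lift_level v
  have hc := color_cases v
  rw [torusCube, if_pos (by omega), solution, proj_lift]
  congr 2
  omega

variable {A B : P₀}

/-- By Cramer's rule the determinant `d` of `A, B` kills the quotient, which is generated by the
classes of `e₁₂` and `e₂₃`. -/
theorem finite_torus (hAB : LinearIndependent ℤ ![A, B]) : Finite (Torus A B) := by
  rw [LinearIndependent.pair_iff] at hAB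
  set d : ℤ := A.1.1 * B.1.2.1 - A.1.2.1 * B.1.1 with hd
  have hd0 : d ≠ 0 := by
    intro h0
    obtain ⟨h1, h2⟩ := hAB B.1.1 (-A.1.1) (by
      rw [P₀.ext_iff']
      simp
      constructor <;> linarith)
    obtain ⟨h3, h4⟩ := hAB B.1.2.1 (-A.1.2.1) (by
      rw [P₀.ext_iff']
      simp
      constructor <;> linarith)
    have := (hAB 1 0 (by
      rw [P₀.ext_iff']
      simp
      constructor <;> linarith)).1
    omega
  have hmem : ∀ w : P₀, d • w ∈ AddSubgroup.closure ({A, B} : Set P₀) := by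
    intro w
    have e : d • w = (w.1.1 * B.1.2.1 - w.1.2.1 * B.1.1) • A +
        (A.1.1 * w.1.2.1 - A.1.2.1 * w.1.1) • B := by
      rw [P₀.ext_iff']
      simp [hd]
      constructor <;> ring
    rw [e]
    exact add_mem (zsmul_mem (AddSubgroup.subset_closure (by simp)) _)
      (zsmul_mem (AddSubgroup.subset_closure (by simp)) _)
  have hz : ∀ τ : Torus A B, d • τ = 0 := by
    intro τ
    obtain ⟨w, rfl⟩ := QuotientAddGroup.mk_surjective τ
    exact (QuotientAddGroup.eq_zero_iff _).mpr (hmem w)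
  have hm : ∀ (i : ℤ) (τ : Torus A B), i • τ = (i % d) • τ := by
    intro i τ
    conv_lhs => rw [← Int.emod_add_mul_ediv i d, add_zsmul, mul_zsmul, hz, add_zero]
  refine Finite.of_surjective (fun p : Finset.Ico (0 : ℤ) |d| × Finset.Ico (0 : ℤ) |d| =>
    (p.1 : ℤ) • (QuotientAddGroup.mk e₁₂ : Torus A B) +
      (p.2 : ℤ) • (QuotientAddGroup.mk e₂₃ : Torus A B)) ?_
  intro τ
  obtain ⟨w, rfl⟩ := QuotientAddGroup.mk_surjective τ
  have hI : ∀ i : ℤ, i % d ∈ Finset.Ico 0 |d| := fun i =>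
    Finset.mem_Ico.mpr ⟨Int.emod_nonneg _ hd0, Int.emod_lt_abs _ hd0⟩
  refine ⟨(⟨_, hI w.1.1⟩, ⟨_, hI (w.1.1 + w.1.2.1)⟩), ?_⟩
  simp only
  rw [← hm, ← hm]
  conv_rhs => rw [eq_smul_e w]
  rfl

/-- The color of a point of the torus. -/
def torusColor (hA : color A = 0) (hB : color B = 0) : Torus A B →+ ZMod 3 :=
  QuotientAddGroup.lift _ colorHom <| by
    rw [AddSubgroup.closure_le]
    rintro w (rfl | rfl)
    · exact (colorHom_eq_zero_iff _).mpr hA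
    · exact (colorHom_eq_zero_iff _).mpr hB

theorem torusColor_mk (hA : color A = 0) (hB : color B = 0) (v : P₀) :
    torusColor hA hB (QuotientAddGroup.mk v) = colorHom v := rfl

/-- If the three directions agree in the torus, then the torus has only three points. -/
theorem mem_closure_of_e_eq
    (h2 : (QuotientAddGroup.mk e₁₂ : Torus A B) = QuotientAddGroup.mk e₂₃)
    (h3 : (QuotientAddGroup.mk e₁₂ : Torus A B) = QuotientAddGroup.mk e₃₁) {w : P₀}
    (hw : color w = 0) : w ∈ AddSubgroup.closure ({A, B} : Set P₀) := by
  rw [← QuotientAddGroup.eq_zero_iff]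
  have hs : (3 : ℤ) • (QuotientAddGroup.mk e₁₂ : Torus A B) = 0 := by
    have := congrArg (QuotientAddGroup.mk : P₀ → Torus A B) e_sum
    change (QuotientAddGroup.mk e₁₂ : Torus A B) + QuotientAddGroup.mk e₂₃ +
      QuotientAddGroup.mk e₃₁ = 0 at this
    rw [← h2, ← h3] at this
    rw [← this]
    abel
  obtain ⟨k, hk⟩ : ∃ k : ℤ, w.1.1 + (w.1.1 + w.1.2.1) = k * 3 := by
    have h0 : w.1.1 + w.1.2.1 + w.1.2.2 = 0 := w.2
    unfold color at hw
    exact ⟨(w.1.1 + (w.1.1 + w.1.2.1)) / 3, by omega⟩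
  rw [eq_smul_e w]
  change w.1.1 • (QuotientAddGroup.mk e₁₂ : Torus A B) +
    (w.1.1 + w.1.2.1) • (QuotientAddGroup.mk e₂₃ : Torus A B) = 0
  rw [← h2, ← add_zsmul, hk, mul_zsmul, hs, zsmul_zero]

/-- Initial values of the tropical evolution: `1` at the point `u`, at the time of its color. -/
noncomputable def tropInit {T : Type} [AddCommGroup T] (χ : T →+ ZMod 3) (u : T) (t : ℕ) (τ : T) :
    ℤ :=
  open Classical in if τ = u ∧ χ u = t then 1 else 0

/-- A translate of `δ_u`, up to sign, is the only nonzero ingredient of the three terms at a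
suitable time, so flatness forces the directions to agree. -/
theorem not_isFlat_tropInit {T : Type} [AddCommGroup T] {e₁ e₂ e₃ : T} (χ : T →+ ZMod 3) (u : T)
    (h : ¬ (e₁ = e₂ ∧ e₁ = e₃)) :
    ¬ (IsFlat e₁ e₂ e₃ (tropEvolve e₁ e₂ e₃ (tropInit χ u)) 0 ∧
      IsFlat e₁ e₂ e₃ (tropEvolve e₁ e₂ e₃ (tropInit χ u)) 1) := by
  classical
  rintro ⟨h0, h1⟩
  refine h ?_
  have one_eq : ∀ (p : Prop) [Decidable p], (1 : ℤ) = (if p then 1 else 0) → p := by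
    intro p _ hp
    by_contra hn
    rw [if_neg hn] at hp
    exact one_ne_zero hp
  have sub_add : ∀ e, u - e₁ + e = u → e₁ = e := fun e h => by
    rw [sub_add_eq_add_sub, sub_eq_iff_eq_add] at h
    exact (add_left_cancel h).symm
  have add_sub : ∀ e, u + e₁ - e = u → e₁ = e := fun e h => by
    rw [sub_eq_iff_eq_add] at h
    exact add_left_cancel h
  obtain hu | hu | hu : χ u = 0 ∨ χ u = 1 ∨ χ u = 2 := by
    generalize χ u = z
    revert z
    decide
  · have x0 : ∀ τ, tropEvolve e₁ e₂ e₃ (tropInit χ u) 0 τ = if τ = u then 1 else 0 := fun τ => by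
      simp [tropEvolve, tropInit, hu]
    have x1 : ∀ τ, tropEvolve e₁ e₂ e₃ (tropInit χ u) 1 τ = 0 := fun τ => by
      simp [tropEvolve, tropInit, hu]
    have x2 : ∀ τ, tropEvolve e₁ e₂ e₃ (tropInit χ u) 2 τ = 0 := fun τ => by
      simp only [tropEvolve, tropInit, hu]
      exact if_neg fun h => absurd h.2 (by decide)
    have x3 : ∀ τ, tropEvolve e₁ e₂ e₃ (tropInit χ u) 3 τ = -if τ = u then 1 else 0 := fun τ => by
      have := isTropEvolution_tropEvolve e₁ e₂ e₃ (tropInit χ u) 0 τ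
      simp only [zero_add, x1, x2, x0] at this
      simp only [max_self] at this
      linarith
    -- For color `0` the initial `1` enters the three terms only after one step, as `-1` at time
    -- `3`; hence flatness at time `1` is used.
    have := h1 (u - e₁)
    simp only [show (1 + 2 : ℕ) = 3 by rfl, show (1 + 1 : ℕ) = 2 by rfl, x3, x2,
      sub_add_cancel, if_true, add_zero, neg_inj] at this
    exact ⟨sub_add _ (one_eq _ this.1), sub_add _ (one_eq _ this.2)⟩
  · have x1 : ∀ τ, tropEvolve e₁ e₂ e₃ (tropInit χ u) 1 τ = if τ = u then 1 else 0 := fun τ => by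
      simp [tropEvolve, tropInit, hu]
    have x2 : ∀ τ, tropEvolve e₁ e₂ e₃ (tropInit χ u) 2 τ = 0 := fun τ => by
      simp only [tropEvolve, tropInit, hu]
      exact if_neg fun h => absurd h.2 (by decide)
    have := h0 (u + e₁)
    simp only [zero_add, x1, x2, add_sub_cancel_right, if_true] at this
    exact ⟨add_sub _ (one_eq _ this.1), add_sub _ (one_eq _ this.2)⟩
  · have x2 : ∀ τ, tropEvolve e₁ e₂ e₃ (tropInit χ u) 2 τ = if τ = u then 1 else 0 := fun τ => by
      simp [tropEvolve, tropInit, hu]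
    have x1 : ∀ τ, tropEvolve e₁ e₂ e₃ (tropInit χ u) 1 τ = 0 := fun τ => by
      simp only [tropEvolve, tropInit, hu]
      exact if_neg fun h => absurd h.2 (by decide)
    have := h0 (u - e₁)
    simp only [zero_add, x1, x2, sub_add_cancel, if_true, add_zero] at this
    exact ⟨sub_add _ (one_eq _ this.1), sub_add _ (one_eq _ this.2)⟩

theorem isTrop_of_isTropEvolution {D : ℕ → Torus A B → ℤ}
    (hD : IsTropEvolution (QuotientAddGroup.mk e₁₂ : Torus A B) (QuotientAddGroup.mk e₂₃)
      (QuotientAddGroup.mk e₃₁) D) :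
    IsTrop fun a b c => D (a + b + c).toNat (QuotientAddGroup.mk (proj a b c)) := by
  intro a b c h
  obtain ⟨t, ht⟩ := Int.eq_ofNat_of_zero_le h
  have key := hD t (QuotientAddGroup.mk (proj (a + 1) (b + 1) (c + 1)))
  have p : ∀ v w : P₀, (QuotientAddGroup.mk v : Torus A B) + QuotientAddGroup.mk w =
    QuotientAddGroup.mk (v + (1 : ℤ) • w) := fun v w => by rw [one_smul]; rfl
  have m : ∀ v w : P₀, (QuotientAddGroup.mk v : Torus A B) - QuotientAddGroup.mk w =
    QuotientAddGroup.mk (v - (1 : ℤ) • w) := fun v w => by rw [one_smul]; rfl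
  rw [p, p, p, m, m, m, proj_add_e₁₂, proj_add_e₂₃, proj_add_e₃₁, proj_sub_e₁₂, proj_sub_e₂₃,
    proj_sub_e₃₁] at key
  simp only
  rw [show (a + 1 + (b + 1) + (c + 1)).toNat = t + 3 by omega,
      show (a + b + c).toNat = t by omega,
      show (a + (b + 1) + (c + 1)).toNat = t + 2 by omega,
      show (a + 1 + b + (c + 1)).toNat = t + 2 by omega,
      show (a + 1 + (b + 1) + c).toNat = t + 2 by omega,
      show (a + 1 + b + c).toNat = t + 1 by omega,
      show (a + (b + 1) + c).toNat = t + 1 by omega,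
      show (a + b + (c + 1)).toNat = t + 1 by omega, ← key, proj_add_one]

/-- The point of the torus below a point of `ℤ³`. -/
def torusProj (A B : P₀) (w : ℤ × ℤ × ℤ) : Torus A B := QuotientAddGroup.mk (proj w.1 w.2.1 w.2.2)

/-- The number of exponents in the value at level `a + b + c` is at most quadratic. -/
theorem card_le {a b c : ℤ} (h0 : 0 ≤ a + b + c) (S : Finset (ℤ × ℤ × ℤ))
    (hS : ∀ u v w : ℤ, (u, v, w) ∈ S →
      u ≤ a ∧ v ≤ b ∧ w ≤ c ∧ 0 ≤ u + v + w ∧ u + v + w ≤ 2) :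
    (S.card : ℤ) ≤ 3 * (a + b + c + 1) ^ 2 := by
  classical
  obtain ⟨L, hL⟩ := Int.eq_ofNat_of_zero_le h0
  -- A point is determined by `a - u`, `b - v` and its level. The first two are at most `L`, because
  -- the level is nonnegative and the other coordinates are bounded above.
  have hsub : S ⊆ (Finset.range (L + 1) ×ˢ Finset.range (L + 1) ×ˢ Finset.range 3).image
      fun q : ℕ × ℕ × ℕ => (a - q.1, b - q.2.1, (q.2.2 : ℤ) - (a - q.1) - (b - q.2.1)) := by
    rintro ⟨u, v, w⟩ hw
    have := hS u v w hw
    refine Finset.mem_image.mpr ⟨((a - u).toNat, (b - v).toNat, (u + v + w).toNat), ?_, ?_⟩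
    · simp only [Finset.mem_product, Finset.mem_range]
      omega
    · simp only [Prod.mk.injEq]
      omega
  have := (Finset.card_le_card hsub).trans Finset.card_image_le
  simp only [Finset.card_product, Finset.card_range] at this
  rw [hL]
  have h' : ((S.card : ℕ) : ℤ) ≤ ((L + 1) * ((L + 1) * 3) : ℕ) := by exact_mod_cast this
  push_cast at h'
  linarith

/-- The exponents in the torus are at most quadratic in the level. -/
theorem abs_exponent_le {T : Type} (κ : ℤ × ℤ × ℤ → T) {a b c : ℤ} (h0 : 0 ≤ a + b + c)
    {p : MvPolynomial (ℤ × ℤ × ℤ) ℤ} {m : ℤ × ℤ × ℤ →₀ ℕ}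
    (hp : ∀ (F : ℤ → ℤ → ℤ → ℝ) (x : ℤ × ℤ × ℤ → ℝ), IsSol F → IsInit F x →
      F a b c * evalAt x (MvPolynomial.monomial m (1 : ℤ)) = evalAt x p)
    {e : T →₀ ℤ} (he : e ∈ (quotientPoly κ p m).coeff.support) (u : T) :
    |e u| ≤ 12 * (a + b + c + 1) ^ 2 := by
  classical
  obtain ⟨e', he', rfl⟩ := exists_of_mem_support_quotientPoly he
  have hb := exponent_bound h0 hp he'
  have hcard := card_le h0 e'.support fun u v w hw => by
    by_contra hn
    exact Finsupp.mem_support_iff.mp hw ((hb u v w).2 hn)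
  have h1 : |e'.mapDomain κ u| ≤ e'.support.card • (4 : ℤ) := by
    rw [Finsupp.mapDomain, Finsupp.sum, Finsupp.finsetSum_apply]
    refine (Finset.abs_sum_le_sum_abs _ _).trans (Finset.sum_le_card_nsmul _ _ _ ?_)
    rintro ⟨i, j, k⟩ _
    rw [Finsupp.single_apply]
    split_ifs
    · exact (hb i j k).1
    · simp
  rw [nsmul_eq_mul] at h1
  linarith

end CubeRecurrence

/-! ### Laurent polynomials on the torus and the two bounds for their degrees -/

namespace CubeRecurrence

variable {A B : P₀}

theorem isInit_solution {K : Type} [Field K] {y : Torus A B → K} (hy : ∀ u, y u ≠ 0) :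
    IsInit (solution fun v => y (QuotientAddGroup.mk v)) fun w => y (torusProj A B w) where
  eq a b c _ h2 := (solution_init (fun v => y (QuotientAddGroup.mk v)) a b c h2).symm
  ne_zero _ := hy _

/-- The values of the cube recurrence in the torus, as Laurent polynomials in the initial values
with quadratically bounded exponents. -/
theorem exists_laurentPoly (A B : P₀) {a b c : ℤ} (h0 : 0 ≤ a + b + c) :
    ∃ q : LaurentPoly (Torus A B),
      (∀ (K : Type) [Field K] (y : Torus A B → K), (∀ u, y u ≠ 0) →
        (∀ n v, evolve (fun v => y (QuotientAddGroup.mk v)) 1 n v ≠ 0) →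
        q.evalAt y = solution (fun v => y (QuotientAddGroup.mk v)) a b c) ∧
      ∀ e ∈ q.coeff.support, ∀ u, |e u| ≤ 12 * (a + b + c + 1) ^ 2 := by
  obtain ⟨p, m, h⟩ := isLaurentAt (a + b + c).toNat a b c (by omega)
  -- One polynomial serves all fields: rational functions identify it with the value of the
  -- recurrence, real numbers give its degree.
  refine ⟨quotientPoly (torusProj A B) p m, fun K _ y hy hev => ?_, fun e he u =>
    abs_exponent_le _ h0 (h ℝ) he u⟩
  have h1 := h K _ _ (isSol_solution hev) (isInit_solution hy)
  have h2 := evalAt_quotientPoly hy (torusProj A B) p m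
  exact mul_right_cancel₀ (evalAt_monomial_ne_zero (fun w => hy _) m) (h2.trans h1.symm)

/-- Here `ε + 3 * n + 1 ≤ 6 * n`, and `432 = 12 * 6 ^ 2`. -/
theorem abs_le_of_le_level {d n ε : ℤ} (hε : 0 ≤ ε ∧ ε ≤ 2) (hn : 1 ≤ n)
    (h : |d| ≤ 12 * (ε + 3 * n + 1) ^ 2) : |(d : ℝ)| ≤ 432 * (n : ℝ) ^ 2 := by
  have : |d| ≤ 432 * n ^ 2 := by nlinarith [hε.1, hε.2]
  exact_mod_cast this

/-- If the three directions do not agree in the torus, the degrees grow quadratically. -/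
theorem exists_quadratic_le_degreeIn (hAB : LinearIndependent ℤ ![A, B]) (hA : color A = 0)
    (hB : color B = 0) (h : ¬ ((QuotientAddGroup.mk e₁₂ : Torus A B) = QuotientAddGroup.mk e₂₃ ∧
      (QuotientAddGroup.mk e₁₂ : Torus A B) = QuotientAddGroup.mk e₃₁)) (u : Torus A B) :
    ∃ c : ℝ, 0 < c ∧ ∃ t₀ : ℕ, ∀ t ≥ t₀, ∀ i j k : ℤ, i + j + k = t →
      ∀ q : LaurentPoly (Torus A B),
      (∀ (K : Type) [Field K] (y : Torus A B → K), (∀ u, y u ≠ 0) →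
        (∀ n v, evolve (fun v => y (QuotientAddGroup.mk v)) 1 n v ≠ 0) →
        q.evalAt y = solution (fun v => y (QuotientAddGroup.mk v)) i j k) →
      c * (t : ℝ) ^ 2 ≤ (degreeIn u q : ℝ) := by
  classical
  have := finite_torus hAB
  have := Fintype.ofFinite (Torus A B)
  set χ := torusColor hA hB
  set D := tropEvolve (QuotientAddGroup.mk e₁₂ : Torus A B) (QuotientAddGroup.mk e₂₃)
    (QuotientAddGroup.mk e₃₁) (tropInit χ u) with hDdef
  have hD := isTropEvolution_tropEvolve (QuotientAddGroup.mk e₁₂ : Torus A B)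
    (QuotientAddGroup.mk e₂₃) (QuotientAddGroup.mk e₃₁) (tropInit χ u)
  have hlow : ∀ t : ℕ, t < 3 → D t = tropInit χ u t := by
    intro t ht
    interval_cases t <;> rfl
  have h01 : ∀ (t : ℕ) (τ : Torus A B), 0 ≤ tropInit χ u t τ ∧ tropInit χ u t τ ≤ 1 := by
    intro t τ
    unfold tropInit
    split_ifs <;> norm_num
  obtain ⟨c, hc, t₀, hct⟩ := exists_quadratic_le (congrArg QuotientAddGroup.mk e_sum) hD χ
    (show colorHom e₁₂ = 2 by decide) (show colorHom e₂₃ = 2 by decide)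
    (fun τ => by
      obtain ⟨w, rfl⟩ := QuotientAddGroup.mk_surjective τ
      exact ⟨_, _, congrArg QuotientAddGroup.mk (eq_smul_e w)⟩)
    (not_isFlat_tropInit χ u h)
    (fun t ht τ hτ => by
      rw [← hDdef, hlow t ht]
      exact if_neg fun h' : τ = u ∧ χ u = t => hτ (h'.1 ▸ h'.2))
    (fun τ e => by
      rw [← hDdef, hlow 0 (by norm_num), hlow 1 (by norm_num), hlow 2 (by norm_num)]
      have a0 := h01 0 τ
      have a1 := h01 1 τ
      have a2 := h01 1 (τ - e)
      have a3 := h01 2 (τ - e)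
      omega)
  refine ⟨c, hc, t₀, fun t ht i j k hijk q hq => ?_⟩
  have hχ : χ (QuotientAddGroup.mk (proj i j k)) = (t : ZMod 3) := by
    rw [torusColor_mk, colorHom_proj, hijk, Int.cast_natCast]
  refine (hct t ht (QuotientAddGroup.mk (proj i j k)) hχ).trans ?_
  have hpos : ∀ s : ℝ, 1 ≤ s → ∀ n v, 0 < evolve (fun v => s ^ (Pi.single u 1 : Torus A B → ℤ)
      (QuotientAddGroup.mk v)) 1 n v := fun s hs n v =>
    evolve_pos (fun _ => zpow_pos (by linarith) _) 1 n v
  obtain ⟨l, _, hl, _, hle⟩ := isTheta_of_isTrop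
    (F := fun s => solution fun v => s ^ (Pi.single u 1 : Torus A B → ℤ) (QuotientAddGroup.mk v))
    (fun s hs => isSol_solution fun n v => (hpos s hs n v).ne') (isTrop_of_isTropEvolution hD)
    (fun a b c h0 h2 => by
      obtain ⟨r, hr⟩ := Int.eq_ofNat_of_zero_le h0
      -- On the levels `0, 1, 2` the color of a point is its level, so the condition on time in
      -- `tropInit` holds automatically at `u`.
      have e : D (a + b + c).toNat (QuotientAddGroup.mk (proj a b c)) =
          (Pi.single u 1 : Torus A B → ℤ) (QuotientAddGroup.mk (proj a b c)) := by
        rw [hr, Int.toNat_natCast, hlow r (by omega), tropInit, Pi.single_apply]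
        by_cases hu : QuotientAddGroup.mk (proj a b c) = u
        · have hχ' : χ u = (r : ZMod 3) := by
            rw [← hu, torusColor_mk, colorHom_proj, hr, Int.cast_natCast]
          rw [if_pos hu, if_pos ⟨hu, hχ'⟩]
        · rw [if_neg hu, if_neg fun h' => hu h'.1]
      rw [← hDdef, e]
      have := IsTheta.const_mul_zpow one_pos
        ((Pi.single u 1 : Torus A B → ℤ) (QuotientAddGroup.mk (proj a b c)))
      exact this.congr fun s _ => by rw [one_mul, solution_init _ a b c h2]) t i j k hijk
  -- Put `x_u = s` and all other variables equal to `1`: the order of growth in `s` is the value of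
  -- `D`.
  have := le_degreeIn_of_le_evalAt q u _ hl fun s hs => by
    rw [hq ℝ _ (fun v => (zpow_pos (by linarith) _).ne') fun n v => (hpos s hs n v).ne']
    exact (hle s hs).1
  rw [hijk, Int.toNat_natCast] at this
  exact_mod_cast this

end CubeRecurrence

theorem mainTheorem5 (A B : CubeRecurrence.P₀) (hAB : LinearIndependent ℤ ![A, B])
    (hA : CubeRecurrence.color A = 0) (hB : CubeRecurrence.color B = 0)
    (v : CubeRecurrence.P₀) :
    ∃ p : ℕ → CubeRecurrence.LaurentPoly (CubeRecurrence.Torus A B),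
      (∀ n : ℕ, (p n).toRatFun =
        CubeRecurrence.torusCube A B v (CubeRecurrence.color v + 3 * (n : ℤ))) ∧
      CubeRecurrence.ZeroAlgebraicEntropy p ∧
      CubeRecurrence.DegreesBigO p 2 ∧
      ((∃ w : CubeRecurrence.P₀, CubeRecurrence.color w = 0 ∧
          w ∉ AddSubgroup.closure ({A, B} : Set CubeRecurrence.P₀)) →
        ∀ u : CubeRecurrence.Torus A B,
          CubeRecurrence.GrowsQuadratically fun n => CubeRecurrence.degreeIn u (p n)) := by
  open CubeRecurrence in
  have hlev : ∀ n : ℕ, (lift v).1 + (n : ℤ) + ((lift v).2.1 + n) + ((lift v).2.2 + n) =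
      color v + 3 * (n : ℤ) := fun n => by
    rw [← lift_level v]
    ring
  have hcol : 0 ≤ color v ∧ color v ≤ 2 := by
    have := color_cases v
    omega
  choose p hp hexp using fun n : ℕ => exists_laurentPoly A B (a := (lift v).1 + n)
    (b := (lift v).2.1 + n) (c := (lift v).2.2 + n) (by rw [hlev]; omega)
  have hupper : ∀ (u : Torus A B) (n : ℕ), 1 ≤ n →
      |(degreeIn u (p n) : ℝ)| ≤ 432 * (n : ℝ) ^ 2 ∧
      |(lowDegreeIn u (p n) : ℝ)| ≤ 432 * (n : ℝ) ^ 2 := by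
    intro u n hn
    have hb : ∀ m ∈ (p n).coeff.support, |m u| ≤ 12 * (color v + 3 * (n : ℤ) + 1) ^ 2 :=
      fun m hm => by
        rw [← hlev]
        exact hexp n m hm u
    have h1 : (1 : ℤ) ≤ n := by exact_mod_cast hn
    exact ⟨abs_le_of_le_level hcol h1 (abs_degreeIn_le u (by positivity) hb),
      abs_le_of_le_level hcol h1 (abs_lowDegreeIn_le u (by positivity) hb)⟩
  have hO : DegreesBigO p 2 := fun u => ⟨432, by
    filter_upwards [Filter.eventually_ge_atTop 1] with n hn
    exact hupper u n hn⟩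
  refine ⟨p, fun n => ?_, ⟨2, hO⟩, hO, ?_⟩
  · rw [torusCube_eq_solution, ← LaurentPoly.evalAt_var]
    exact hp n _ var var_ne_zero fun k w => (posAtOne_evolve A B 1 k w).ne_zero
  · rintro ⟨w, hw, hmem⟩ u
    obtain ⟨c, hc, t₀, hct⟩ := exists_quadratic_le_degreeIn hAB hA hB
      (fun h => hmem (mem_closure_of_e_eq h.1 h.2 hw)) u
    refine ⟨c, 432, hc, by norm_num, ?_⟩
    filter_upwards [Filter.eventually_ge_atTop (max 1 t₀)] with n hn
    refine ⟨?_, (le_abs_self _).trans (hupper u n ((le_max_left _ _).trans hn)).1⟩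
    -- The lower bound is in terms of the level, which is at least `n`.
    have ht : n ≤ (color v + 3 * (n : ℤ)).toNat := by omega
    refine le_trans ?_ (hct (color v + 3 * (n : ℤ)).toNat
      (((le_max_right _ _).trans hn).trans ht) _ _ _ (by rw [hlev]; omega) (p n)
      fun K _ y => hp n K y)
    have : (n : ℝ) ≤ ((color v + 3 * (n : ℤ)).toNat : ℝ) := by exact_mod_cast ht
    gcongr
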